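/- Let $T_t=e^{it\partial_x^2}$ ($t\in\mathbb{R}$) be the free Schrödinger group on $\mathbb{R}$, let $d_0$ be the $2$-periodic function with $d_0=1$ on $[0,1)$ and $d_0=-1$ on $[1,2)$, and put $D(t)=\int_0^t d_0(t')\,dt'$. Let $d_{\mathrm{av}}\in\mathbb{R}$, $\alpha\ge 2$ and $\varphi\in H^1(\mathbb{R})$. For $\varepsilon>0$ consider the transformed dispersion managed NLS equation $$ i\partial_t v+d_{\mathrm{av}}\partial_x^2 v+T_{D(t/\varepsilon)}^{-1}\bigl(|T_{D(t/\varepsilon)}v|^{\alpha}T_{D(t/\varepsilon)}v\bigr)=0,\qquad v(0)=\varphi, \tag{1}$$ and the averaged equation $$ i\partial_t v+d_{\mathrm{av}}\partial_x^2 v+\int_0^1 T_r^{-1}\bigl(|T_r v|^{\alpha}T_r v\bigr)\,dr=0,\qquad v(0)=\varphi. \tag{2}$$ A solution on an interval $J\ni 0$ is a function $v\in C(J,H^1(\mathbb{R}))$ satisfying on $J$ the corresponding Duhamel formula $$v(t)=e^{itd_{\mathrm{av}}\partial_x^2}\varphi+i\int_0^t e^{i(t-s)d_{\mathrm{av}}\partial_x^2}F(s,v(s))\,ds,$$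 where $F(t,v)$ is the nonlinear term of the equation; a maximal solution is a solution on an open interval $(-T_-,T_+)$, $0<T_\pm\le\infty$, that does not extend to a solution on a larger open interval. Then (2), and (1) for each $\varepsilon>0$, have a unique maximal solution. Let $v$ be the maximal solution of (2), defined on $(-T_-,T_+)$, and let $v_\varepsilon$ be the maximal solution of (1). For every $M$ with $0<M<\min\{T_-,T_+\}$, the solution $v_\varepsilon$ exists on $[-M,M]$ for all sufficiently small $\varepsilon>0$, and $$\lim_{\varepsilon\to 0^+}\|v_\varepsilon-v\|_{L^\infty([-M,M],H^1(\mathbb{R}))}=0.$$ -/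

import Mathlib

open MeasureTheory FourierTransform
open scoped LineDeriv SchwartzMap ENNReal ContDiff

noncomputable section

namespace DMNLS

/-- The complex Hilbert space `L²(ℝ)`. -/
abbrev L2 : Type := Lp ℂ 2 (volume : Measure ℝ)

/-- `H¹(ℝ)` as a linear subspace, realised as the space of pairs `(f, f')` with `f, f' ∈ L²(ℝ)` and `f'` the
distributional derivative of `f`.  The norm it inherits is
`‖f‖_{H¹} = (‖f‖² + ‖f'‖²) ^ (1 / 2)`. -/
def H1Submodule : Submodule ℂ (WithLp 2 (L2 × L2)) where
  carrier := {p | ∂_{(1 : ℝ)} (p.fst : 𝓢'(ℝ, ℂ)) = (p.snd : 𝓢'(ℝ, ℂ))}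
  add_mem' {p q} hp hq := by
    simp only [Set.mem_ofPred_eq, WithLp.add_fst, WithLp.add_snd,
      ← Lp.toTemperedDistributionCLM_apply, map_add, LineDeriv.lineDerivOp_add] at *
    rw [hp, hq]
  zero_mem' := by
    simp only [Set.mem_ofPred_eq, WithLp.zero_fst, WithLp.zero_snd,
      ← Lp.toTemperedDistributionCLM_apply, map_zero, LineDeriv.lineDerivOp_zero]
  smul_mem' c p hp := by
    simp only [Set.mem_ofPred_eq, WithLp.smul_fst, WithLp.smul_snd,
      ← Lp.toTemperedDistributionCLM_apply, map_smul, LineDeriv.lineDerivOp_smul] at *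
    rw [hp]

/-- The Sobolev space `H¹(ℝ)` of complex-valued functions. -/
abbrev H1 : Type := H1Submodule

namespace H1

/-- The underlying `L²` function of an element of `H¹`. -/
def toL2 (f : H1) : L2 := (f : WithLp 2 (L2 × L2)).fst

/-- The weak derivative of an element of `H¹`. -/
def weakDeriv (f : H1) : L2 := (f : WithLp 2 (L2 × L2)).snd

end H1

/-- The Fourier symbol `exp (-i t (2πξ)²)` of `exp (i t ∂ₓ²)`, for the Fourier transform
`∫ exp (-2πixξ) f x dx`. -/
def symbol (t ξ : ℝ) : ℂ := Complex.exp (((-(t * (2 * Real.pi * ξ) ^ 2) : ℝ) : ℂ) * Complex.I)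

theorem norm_symbol (t ξ : ℝ) : ‖symbol t ξ‖ = 1 := Complex.norm_exp_ofReal_mul_I _

theorem continuous_symbol (t : ℝ) : Continuous (symbol t) := by unfold symbol; fun_prop

theorem symbol_neg_mul (t ξ : ℝ) : symbol (-t) ξ * symbol t ξ = 1 := by
  rw [symbol, symbol, ← Complex.exp_add]
  simp

theorem memLp_symbol_mul (t : ℝ) (f : L2) :
    MemLp (fun ξ ↦ symbol t ξ * f ξ) 2 (volume : Measure ℝ) :=
  (Lp.memLp f).of_le
    ((continuous_symbol t).aestronglyMeasurable.mul (Lp.aestronglyMeasurable f))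
    (by filter_upwards with ξ; simp [norm_symbol])

/-- Multiplication by the symbol on `L²`. -/
def mulSymbolFun (t : ℝ) (f : L2) : L2 := (memLp_symbol_mul t f).toLp _

theorem mulSymbolFun_coe (t : ℝ) (f : L2) :
    mulSymbolFun t f =ᵐ[volume] fun ξ ↦ symbol t ξ * f ξ := MemLp.coeFn_toLp _

theorem mulSymbolFun_neg (t : ℝ) (f : L2) : mulSymbolFun (-t) (mulSymbolFun t f) = f := by
  ext1
  filter_upwards [mulSymbolFun_coe (-t) (mulSymbolFun t f), mulSymbolFun_coe t f] with ξ h1 h2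
  rw [h1, h2, ← mul_assoc, symbol_neg_mul, one_mul]

/-- Multiplication by the symbol as a unitary operator on `L²`. -/
def mulSymbol (t : ℝ) : L2 ≃ₗᵢ[ℂ] L2 where
  toFun := mulSymbolFun t
  invFun := mulSymbolFun (-t)
  left_inv f := mulSymbolFun_neg t f
  right_inv f := by simpa using mulSymbolFun_neg (-t) f
  map_add' f g := by
    ext1
    filter_upwards [mulSymbolFun_coe t (f + g), mulSymbolFun_coe t f, mulSymbolFun_coe t g,
      Lp.coeFn_add f g, Lp.coeFn_add (mulSymbolFun t f) (mulSymbolFun t g)] with ξ h1 h2 h3 h4 h5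
    rw [h1, h5, Pi.add_apply, h2, h3, h4, Pi.add_apply, mul_add]
  map_smul' c f := by
    ext1
    filter_upwards [mulSymbolFun_coe t (c • f), mulSymbolFun_coe t f,
      Lp.coeFn_smul c f, Lp.coeFn_smul c (mulSymbolFun t f)] with ξ h1 h2 h3 h4
    simp only [RingHom.id_apply]
    rw [h1, h4, Pi.smul_apply, h2, h3, Pi.smul_apply, smul_eq_mul, smul_eq_mul]
    ring
  norm_map' f := by
    change ‖mulSymbolFun t f‖ = ‖f‖
    rw [Lp.norm_def, Lp.norm_def]
    congr 1
    apply eLpNorm_congr_norm_ae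
    filter_upwards [mulSymbolFun_coe t f] with ξ h1
    rw [h1, norm_mul, norm_symbol, one_mul]

/-- The free Schrödinger group `T_t = exp (i t ∂ₓ²)` on `L²(ℝ)`, the solution operator of
`i ∂_t u + ∂ₓ² u = 0`. -/
def T (t : ℝ) : L2 ≃ₗᵢ[ℂ] L2 :=
  ((Lp.fourierTransformₗᵢ ℝ ℂ).trans (mulSymbol t)).trans (Lp.fourierTransformₗᵢ ℝ ℂ).symm

/-- `g` is the distributional derivative of `f` iff `𝓕 g = 2πiξ 𝓕 f` almost everywhere. -/
theorem lineDeriv_eq_iff (f g : L2) :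
    ∂_{(1 : ℝ)} (f : 𝓢'(ℝ, ℂ)) = (g : 𝓢'(ℝ, ℂ)) ↔
      (𝓕 g : L2) =ᵐ[volume] fun ξ ↦ (2 * Real.pi * Complex.I * ξ) * (𝓕 f : L2) ξ := by
  have key : ∀ u : 𝓢(ℝ, ℂ), 𝓕 (∂_{(1 : ℝ)} (f : 𝓢'(ℝ, ℂ))) u =
      ∫ ξ : ℝ, u ξ • ((2 * Real.pi * Complex.I * ξ) * (𝓕 f : L2) ξ) := by
    intro u
    have ht : (fun x : ℝ ↦ (inner ℝ x (1 : ℝ) : ℂ)).HasTemperateGrowth := by fun_prop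
    rw [TemperedDistribution.fourier_lineDerivOp_eq, Lp.fourier_toTemperedDistribution_eq]
    change (2 * Real.pi * Complex.I) • (((𝓕 f : L2) : 𝓢'(ℝ, ℂ))
      (SchwartzMap.smulLeftCLM ℂ (fun x : ℝ ↦ (inner ℝ x (1 : ℝ) : ℂ)) u)) = _
    rw [Lp.toTemperedDistribution_apply, ← integral_smul]
    congr 1
    ext ξ
    rw [SchwartzMap.smulLeftCLM_apply_apply ht]
    simp
    ring
  have inj : ∂_{(1 : ℝ)} (f : 𝓢'(ℝ, ℂ)) = (g : 𝓢'(ℝ, ℂ)) ↔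
      𝓕 (∂_{(1 : ℝ)} (f : 𝓢'(ℝ, ℂ))) = 𝓕 (g : 𝓢'(ℝ, ℂ)) := by
    constructor
    · intro h; rw [h]
    · intro h
      have := congrArg (fun v : 𝓢'(ℝ, ℂ) ↦ 𝓕⁻ v) h
      simpa using this
  rw [inj, Lp.fourier_toTemperedDistribution_eq]
  constructor
  · intro h
    apply ae_eq_of_integral_contDiff_smul_eq
    · exact (Lp.memLp _).locallyIntegrable (by norm_num)
    · have h1 : LocallyIntegrable (𝓕 f : L2) (volume : Measure ℝ) :=
        (Lp.memLp _).locallyIntegrable (by norm_num)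
      have h2 : Continuous fun ξ : ℝ ↦ (2 * Real.pi * Complex.I * ξ : ℂ) := by fun_prop
      exact h1.continuous_smul h2
    · intro u hu hc
      have hg₁ : HasCompactSupport (Complex.ofRealCLM ∘ u) := hc.comp_left rfl
      have hg₂ : ContDiff ℝ ∞ (Complex.ofRealCLM ∘ u) := by fun_prop
      have := key (hg₁.toSchwartzMap hg₂)
      rw [h, Lp.toTemperedDistribution_apply] at this
      simpa using this
  · intro h
    ext u
    rw [key, Lp.toTemperedDistribution_apply]
    apply integral_congr_ae
    filter_upwards [h] with ξ hξ
    rw [hξ]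

theorem fourier_T (t : ℝ) (f : L2) :
    (𝓕 (T t f) : L2) =ᵐ[volume] fun ξ ↦ symbol t ξ * (𝓕 f : L2) ξ := by
  have : (𝓕 (T t f) : L2) = mulSymbolFun t (𝓕 f : L2) :=
    (Lp.fourierTransformₗᵢ ℝ ℂ).apply_symm_apply _
  rw [this]
  exact mulSymbolFun_coe _ _

/-- `T_t` preserves `H¹` and commutes with `∂ₓ`. -/
theorem T_mem_H1 (t : ℝ) (f : H1) :
    (WithLp.toLp 2 (T t f.toL2, T t f.weakDeriv) : WithLp 2 (L2 × L2)) ∈ H1Submodule := by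
  have hf : ∂_{(1 : ℝ)} (f.toL2 : 𝓢'(ℝ, ℂ)) = (f.weakDeriv : 𝓢'(ℝ, ℂ)) := f.2
  change ∂_{(1 : ℝ)} (T t f.toL2 : 𝓢'(ℝ, ℂ)) = (T t f.weakDeriv : 𝓢'(ℝ, ℂ))
  rw [lineDeriv_eq_iff] at hf ⊢
  filter_upwards [hf, fourier_T t f.toL2, fourier_T t f.weakDeriv] with ξ h1 h2 h3
  rw [h2, h3, h1]
  ring

/-- The free Schrödinger group on `H¹(ℝ)`. -/
def TH1 (t : ℝ) (f : H1) : H1 := ⟨WithLp.toLp 2 (T t f.toL2, T t f.weakDeriv), T_mem_H1 t f⟩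

/-- Elements of `H¹(ℝ)` are essentially bounded. -/
theorem H1.exists_ae_bound (f : H1) : ∃ C : ℝ, ∀ᵐ x, ‖f.toL2 x‖ ≤ C := by
  set F : L2 := 𝓕 f.toL2 with hF
  have hf : ∂_{(1 : ℝ)} (f.toL2 : 𝓢'(ℝ, ℂ)) = (f.weakDeriv : 𝓢'(ℝ, ℂ)) := f.2
  rw [lineDeriv_eq_iff] at hf
  have hxF : MemLp (fun ξ : ℝ ↦ (2 * Real.pi * Complex.I * ξ) * F ξ) 2 (volume : Measure ℝ) :=
    (Lp.memLp (𝓕 f.weakDeriv : L2)).ae_eq hf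
  have hbd : MemLp (fun ξ : ℝ ↦ (1 + 2 * Real.pi * Complex.I * ξ) * F ξ) 2
      (volume : Measure ℝ) := by
    refine ((Lp.memLp F).add hxF).ae_eq ?_
    filter_upwards with ξ
    simp only [Pi.add_apply]
    ring
  have hne : ∀ ξ : ℝ, (1 + 2 * Real.pi * Complex.I * ξ : ℂ) ≠ 0 := by
    intro ξ h
    have := congrArg Complex.re h
    simp at this
  have hw : MemLp (fun ξ : ℝ ↦ (1 + 2 * Real.pi * Complex.I * ξ : ℂ)⁻¹) 2
      (volume : Measure ℝ) := by
    have hc : Continuous fun ξ : ℝ ↦ (1 + 2 * Real.pi * Complex.I * ξ : ℂ)⁻¹ :=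
      Continuous.inv₀ (by fun_prop) hne
    rw [memLp_two_iff_integrable_sq_norm hc.aestronglyMeasurable]
    refine integrable_inv_one_add_sq.mono' (hc.norm.pow 2).aestronglyMeasurable ?_
    filter_upwards with ξ
    rw [Real.norm_of_nonneg (by positivity), norm_inv, inv_pow]
    apply inv_anti₀ (by positivity)
    rw [Complex.sq_norm, Complex.normSq_apply]
    simp
    nlinarith [Real.pi_gt_three, sq_nonneg ξ, mul_nonneg (sq_nonneg ξ)
      (by nlinarith [Real.pi_gt_three] : (0 : ℝ) ≤ 4 * Real.pi ^ 2 - 1)]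
  have hint : Integrable F (volume : Measure ℝ) := by
    refine (hw.integrable_mul hbd).congr ?_
    filter_upwards with ξ
    simp only [Pi.mul_apply]
    rw [← mul_assoc, inv_mul_cancel₀ (hne ξ), one_mul]
  have hcont : Continuous (𝓕⁻ (F : ℝ → ℂ)) := by
    change Continuous (VectorFourier.fourierIntegral Real.fourierChar volume (-innerₗ ℝ) F)
    exact VectorFourier.fourierIntegral_continuous Real.continuous_fourierChar
      (by simp only [LinearMap.neg_apply, innerₗ_apply_apply]; fun_prop) hint
  refine ⟨∫ ξ, ‖F ξ‖, ?_⟩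
  have hae : ∀ᵐ x, f.toL2 x = 𝓕⁻ (F : ℝ → ℂ) x := by
    apply ae_eq_of_integral_contDiff_smul_eq
    · exact (Lp.memLp _).locallyIntegrable (by norm_num)
    · exact hcont.locallyIntegrable
    · intro u hu hc
      have hg₁ : HasCompactSupport (Complex.ofRealCLM ∘ u) := hc.comp_left rfl
      have hg₂ : ContDiff ℝ ∞ (Complex.ofRealCLM ∘ u) := by fun_prop
      set w : 𝓢(ℝ, ℂ) := hg₁.toSchwartzMap hg₂
      have e1 : ((f.toL2 : 𝓢'(ℝ, ℂ)) : 𝓢'(ℝ, ℂ)) w = (F : 𝓢'(ℝ, ℂ)) (𝓕⁻ w) := by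
        rw [hF, ← Lp.fourier_toTemperedDistribution_eq, TemperedDistribution.fourier_apply,
          fourier_fourierInv_eq]
      rw [Lp.toTemperedDistribution_apply, Lp.toTemperedDistribution_apply] at e1
      have e2 : ∫ ξ, (𝓕⁻ w) ξ • F ξ = ∫ x, w x • 𝓕⁻ (F : ℝ → ℂ) x := by
        rw [SchwartzMap.fourierInv_coe]
        have := VectorFourier.integral_fourierIntegral_smul_eq_flip (L := -innerₗ ℝ)
          (μ := volume) (ν := volume)
          Real.continuous_fourierChar (by simp only [LinearMap.neg_apply, innerₗ_apply_apply]; fun_prop) w.integrable hint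
        have hfl : (-innerₗ ℝ : ℝ →ₗ[ℝ] ℝ →ₗ[ℝ] ℝ).flip = -innerₗ ℝ := by
          ext; simp
        rw [hfl] at this
        exact this
      have := e1.trans e2
      simpa [w] using this
  filter_upwards [hae] with x hx
  rw [hx]
  exact VectorFourier.norm_fourierIntegral_le_integral_norm _ _ _ _ _

/-- `|f|^α f ∈ L²` for `f ∈ H¹`. -/
theorem memLp_power {α : ℝ} (hα : 0 ≤ α) (f : H1) :
    MemLp (fun x ↦ ((‖f.toL2 x‖ ^ α : ℝ) : ℂ) * f.toL2 x) 2 (volume : Measure ℝ) := by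
  obtain ⟨C, hC⟩ := f.exists_ae_bound
  have hm := Lp.aestronglyMeasurable f.toL2
  refine (Lp.memLp f.toL2).of_le_mul (c := C ^ α) ?_ ?_
  · exact (Complex.measurable_ofReal.comp_aemeasurable
      (hm.norm.aemeasurable.pow_const α)).aestronglyMeasurable.mul hm
  · filter_upwards [hC] with x hx
    rw [norm_mul, Complex.norm_real, Real.norm_of_nonneg (by positivity)]
    gcongr

/-- The power nonlinearity `|f|^α f` of `f ∈ H¹`, as an element of `L²` (used for `α ≥ 0`). -/
def power (α : ℝ) (f : H1) : L2 :=
  if hα : 0 ≤ α then (memLp_power hα f).toLp _ else 0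

/-- The `2`-periodic dispersion profile, `1` on `[0, 1)` and `-1` on `[1, 2)`. -/
def d₀ (t : ℝ) : ℝ := if Int.fract (t / 2) < 1 / 2 then 1 else -1

/-- `D(t) = ∫₀ᵗ d₀`. -/
def D (t : ℝ) : ℝ := ∫ s in (0 : ℝ)..t, d₀ s

/-- `T_r⁻¹ (|T_r f|^α T_r f)`. -/
def conjPower (α r : ℝ) (f : H1) : L2 := (T r).symm (power α (TH1 r f))

/-- The nonlinearity `Q(s, f) = T_{D(s)}⁻¹ (|T_{D(s)} f|^α T_{D(s)} f)`. -/
def Q (α s : ℝ) (f : H1) : L2 := conjPower α (D s) f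

/-- The averaged nonlinearity `∫₀¹ T_r⁻¹ (|T_r f|^α T_r f) dr`. -/
def avgQ (α : ℝ) (f : H1) : L2 := ∫ r in (0 : ℝ)..1, conjPower α r f

/-- `v ∈ C(J, H¹)` solves `i ∂_t v + d ∂ₓ² v + F(t, v) = 0`, `v(0) = φ`, on the interval `J ∋ 0`,
in the sense of Duhamel's formula
`v(t) = exp (i t d ∂ₓ²) φ + i ∫₀ᵗ exp (i (t - s) d ∂ₓ²) F(s, v(s)) ds`. -/
structure IsSolution (d : ℝ) (F : ℝ → H1 → L2) (φ : H1) (J : Set ℝ) (v : ℝ → H1) : Prop where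
  continuousOn : ContinuousOn v J
  duhamel : ∀ t ∈ J, (v t).toL2 =
    T (t * d) φ.toL2 + Complex.I • ∫ s in (0 : ℝ)..t, T ((t - s) * d) (F s (v s))

/-- The open interval `(-T₋, T₊)`, with endpoints possibly infinite. -/
def timeInterval (Tm Tp : EReal) : Set ℝ := {t | -Tm < (t : EReal) ∧ (t : EReal) < Tp}

/-- `v` is a maximal `H¹` solution, with maximal interval of existence `(-T₋, T₊)`: it is a
solution there which does not extend to a solution on a larger open interval. -/
structure IsMaximalSolution (d : ℝ) (F : ℝ → H1 → L2) (φ : H1) (Tm Tp : EReal) (v : ℝ → H1) :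
    Prop where
  pos_left : 0 < Tm
  pos_right : 0 < Tp
  isSolution : IsSolution d F φ (timeInterval Tm Tp) v
  maximal : ∀ (Tm' Tp' : EReal) (v' : ℝ → H1), Tm ≤ Tm' → Tp ≤ Tp' →
    IsSolution d F φ (timeInterval Tm' Tp') v' → Set.EqOn v' v (timeInterval Tm Tp) →
    Tm' = Tm ∧ Tp' = Tp

/-- There is a maximal solution, and it is unique: any two have the same interval of existence
and coincide on it. -/
def HasUniqueMaximalSolution (d : ℝ) (F : ℝ → H1 → L2) (φ : H1) : Prop :=
  ∃ (Tm Tp : EReal) (v : ℝ → H1), IsMaximalSolution d F φ Tm Tp v ∧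
    ∀ (Tm' Tp' : EReal) (v' : ℝ → H1), IsMaximalSolution d F φ Tm' Tp' v' →
      Tm' = Tm ∧ Tp' = Tp ∧ Set.EqOn v' v (timeInterval Tm Tp)

/-- The nonlinear term `Q(t / ε, v)` of the transformed dispersion managed equation. -/
abbrev dmForcing (α ε : ℝ) : ℝ → H1 → L2 := fun t f ↦ Q α (t / ε) f

/-- The nonlinear term of the averaged equation. -/
abbrev avgForcing (α : ℝ) : ℝ → H1 → L2 := fun _ f ↦ avgQ α f

end DMNLS

end

/-!
On `H¹(ℝ)` the substitution `w t = exp (-i t d_av ∂ₓ²) (v t)` turns both Duhamel formulas into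
integral equations `w t = φ + ∫₀ᵗ g s (w s) ds` for vector fields `g` on the Banach space `H¹`
(`isSolution_iff_isMildSolution`). These fields are jointly continuous and, on every ball of `H¹`,
bounded and Lipschitz uniformly in time: the Schrödinger group acts by isometries of `H¹`, and
`f ↦ |f|^α f` is Lipschitz on balls of `H¹` (`exists_lipschitzOnWith_powerH1`). The latter rests on
the Sobolev inequality (`H1.exists_sobolev_const`), on the derivative of `z ↦ |z|^α z` being locally
Lipschitz for `α ≥ 2` (`norm_powerDeriv_sub_le`), and on the chain rule for weak derivatives
(`powerPair_mem`), which passes from Schwartz functions to `H¹` by density.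

Hence the equations are ordinary differential equations. Grönwall's inequality gives uniqueness, the
Picard–Lindelöf theorem for the field truncated to a ball gives local existence, and the maximal
solution is the union of all solutions (`IsLocallyWellPosed.exists_largest`).

The convergence is an instance of the averaging principle. The dispersion managed field is
`h (D (s / ε)) s x`, the averaged field is `∫₀¹ h r s x dr`, and over a period `D` runs through
`[0, 1]` twice with unit speed. Along the solution `w` of the averaged equation, the primitive of
the difference of the two fields tends to `0` uniformly, since it oscillates with mean zero in the
fast variable (`exists_norm_integral_oscillating_le`). Grönwall's inequality for the field truncated
to a ball slightly larger than the range of `w` shows that the truncated solution converges to `w`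
(`exists_isMildSolution_near_averaged`); it then stays inside that ball, so that it solves the
original equation and is part of the maximal solution.
-/

noncomputable section

namespace DMNLS

open Set Metric Filter
open scoped NNReal Topology

/-! ### Integral equations in a Banach space -/

section MildSolution

variable {E : Type*} [NormedAddCommGroup E] [NormedSpace ℝ E]

/-- `w` is continuous on `J` and satisfies there the integral form of `w' = g t w`, `w 0 = φ`. -/
structure IsMildSolution (g : ℝ → E → E) (φ : E) (J : Set ℝ) (w : ℝ → E) : Prop where
  continuousOn : ContinuousOn w J
  integral_eq : ∀ t ∈ J, w t = φ + ∫ s in (0 : ℝ)..t, g s (w s)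

/-- A jointly continuous vector field which on each ball is bounded and Lipschitz, uniformly in
time. -/
structure IsLocallyLipschitzField (g : ℝ → E → E) : Prop where
  continuous : Continuous (Function.uncurry g)
  lipschitz : ∀ R : ℝ, ∃ K : ℝ≥0, ∀ t, LipschitzOnWith K (g t) (closedBall 0 R)
  bounded : ∀ R : ℝ, ∃ B : ℝ, ∀ t, ∀ x ∈ closedBall (0 : E) R, ‖g t x‖ ≤ B

theorem IsMildSolution.mono {g : ℝ → E → E} {φ : E} {J J' : Set ℝ} {w : ℝ → E}
    (hw : IsMildSolution g φ J w) (h : J' ⊆ J) : IsMildSolution g φ J' w :=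
  ⟨hw.continuousOn.mono h, fun t ht ↦ hw.integral_eq t (h ht)⟩

theorem le_mul_exp_of_le_integral_of_continuous {u : ℝ → ℝ} {δ K T : ℝ} (hK : 0 ≤ K)
    (hT : 0 ≤ T) (hu : Continuous u)
    (h : ∀ t ∈ Icc 0 T, u t ≤ δ + K * ∫ s in (0 : ℝ)..t, u s) :
    u T ≤ δ * Real.exp (K * T) := by
  set U : ℝ → ℝ := fun t ↦ δ + K * ∫ s in (0 : ℝ)..t, u s with hU
  have hd : ∀ t, HasDerivAt U (K * u t) t := fun t ↦
    ((intervalIntegral.integral_hasDerivAt_right (hu.intervalIntegrable _ _)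
      (hu.stronglyMeasurableAtFilter _ _) hu.continuousAt).const_mul K).const_add δ
  have key := le_gronwallBound_of_liminf_deriv_right_le (f := U) (f' := fun t ↦ K * u t)
    (δ := δ) (K := K) (ε := 0) (a := 0) (b := T)
    (fun t _ ↦ (hd t).continuousAt.continuousWithinAt)
    (fun t _ r hr ↦ (hd t).hasDerivWithinAt.liminf_right_slope_le hr)
    (by simp [hU]) (fun t ht ↦ by
      have := h t ⟨ht.1, ht.2.le⟩
      rw [add_zero]
      exact mul_le_mul_of_nonneg_left this hK) T ⟨hT, le_rfl⟩
  rw [gronwallBound_ε0, sub_zero] at key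
  exact (h T ⟨hT, le_rfl⟩).trans key

/-- Grönwall's inequality in integral form, on an interval on either side of `0`. -/
theorem le_mul_exp_of_le_integral {u : ℝ → ℝ} {δ K T : ℝ} (hK : 0 ≤ K)
    (hu : ContinuousOn u (uIcc 0 T)) (hu0 : ∀ t, 0 ≤ u t)
    (h : ∀ t ∈ uIcc 0 T, u t ≤ δ + K * |∫ s in (0 : ℝ)..t, u s|) :
    u T ≤ δ * Real.exp (K * |T|) := by
  have pos : ∀ {u : ℝ → ℝ} {T : ℝ}, 0 ≤ T → ContinuousOn u (Icc 0 T) → (∀ t, 0 ≤ u t) →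
      (∀ t ∈ Icc 0 T, u t ≤ δ + K * |∫ s in (0 : ℝ)..t, u s|) →
      u T ≤ δ * Real.exp (K * T) := by
    intro u T hT hu hu0 h
    set u' : ℝ → ℝ := IccExtend hT ((Icc 0 T).domRestrict u) with hu'
    have he : ∀ t ∈ Icc 0 T, u' t = u t := fun t ht ↦ by
      rw [hu', IccExtend_of_mem _ _ ht, domRestrict_apply]
    rw [← he T ⟨hT, le_rfl⟩]
    refine le_mul_exp_of_le_integral_of_continuous hK hT
      (continuousOn_iff_continuous_domRestrict.mp hu).Icc_extend' fun t ht ↦ ?_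
    have e : ∫ s in (0 : ℝ)..t, u' s = ∫ s in (0 : ℝ)..t, u s :=
      intervalIntegral.integral_congr fun s hs ↦ by
        rw [uIcc_of_le ht.1] at hs
        exact he s ⟨hs.1, hs.2.trans ht.2⟩
    have := h t ht
    rwa [abs_of_nonneg (intervalIntegral.integral_nonneg ht.1 fun s _ ↦ hu0 s), ← he t ht, ← e]
      at this
  rcases le_total 0 T with hT | hT
  · rw [uIcc_of_le hT] at hu h
    rw [abs_of_nonneg hT]
    exact pos hT hu hu0 h
  · rw [uIcc_of_ge hT] at hu h
    have hm : ∀ t ∈ Icc 0 (-T), -t ∈ Icc T 0 := fun t ht ↦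
      ⟨by linarith [ht.2], by linarith [ht.1]⟩
    have := pos (u := fun t ↦ u (-t)) (T := -T) (by linarith)
      (hu.comp continuous_neg.continuousOn hm) (fun t ↦ hu0 _) fun t ht ↦ by
        have := h (-t) (hm t ht)
        rwa [intervalIntegral.integral_comp_neg (fun s ↦ u s), neg_zero,
          intervalIntegral.integral_symm, abs_neg]
    rw [abs_of_nonpos hT]
    simpa using this

theorem continuousOn_field_comp {E : Type*} [NormedAddCommGroup E] {g : ℝ → E → E}
    (hg : Continuous (Function.uncurry g)) {w : ℝ → E} {J : Set ℝ} (hw : ContinuousOn w J) : ContinuousOn (fun s ↦ g s (w s)) J :=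
  hg.comp_continuousOn (continuousOn_id.prodMk hw)

theorem uIcc_zero_subset {J : Set ℝ} (hJ : J.OrdConnected) (h0 : (0 : ℝ) ∈ J) {t : ℝ}
    (ht : t ∈ J) : uIcc 0 t ⊆ J := hJ.uIcc_subset h0 ht

/-- Stability of mild solutions: the distance of solutions for two fields is controlled by the
integral of the difference of the fields along the second solution. -/
theorem IsMildSolution.norm_sub_le {g g' : ℝ → E → E} {φ : E} {w w' : ℝ → E} {T δ : ℝ} {K : ℝ≥0}
    (hg : Continuous (Function.uncurry g)) (hg' : Continuous (Function.uncurry g'))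
    (hw : IsMildSolution g φ (uIcc 0 T) w) (hw' : IsMildSolution g' φ (uIcc 0 T) w')
    (hK : ∀ s ∈ uIcc 0 T, ‖g s (w s) - g s (w' s)‖ ≤ K * ‖w s - w' s‖)
    (hδ : ∀ t ∈ uIcc 0 T, ‖∫ s in (0 : ℝ)..t, (g s (w' s) - g' s (w' s))‖ ≤ δ) :
    ‖w T - w' T‖ ≤ δ * Real.exp (K * |T|) := by
  refine le_mul_exp_of_le_integral (u := fun t ↦ ‖w t - w' t‖) K.2
    (hw.continuousOn.sub hw'.continuousOn).norm (fun t ↦ norm_nonneg _) fun t ht ↦ ?_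
  have hsub : uIcc 0 t ⊆ uIcc 0 T := uIcc_subset_uIcc left_mem_uIcc ht
  have i1 := ContinuousOn.intervalIntegrable (μ := volume) <|
    ((continuousOn_field_comp hg hw.continuousOn).mono hsub)
  have i2 := ContinuousOn.intervalIntegrable (μ := volume) <|
    ((continuousOn_field_comp hg hw'.continuousOn).mono hsub)
  have i3 := ContinuousOn.intervalIntegrable (μ := volume) <|
    ((continuousOn_field_comp hg' hw'.continuousOn).mono hsub)
  have e : w t - w' t = (∫ s in (0 : ℝ)..t, (g s (w' s) - g' s (w' s))) +
      ∫ s in (0 : ℝ)..t, (g s (w s) - g s (w' s)) := by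
    rw [hw.integral_eq t ht, hw'.integral_eq t ht, intervalIntegral.integral_sub i2 i3,
      intervalIntegral.integral_sub i1 i2]
    abel
  rw [e]
  refine (norm_add_le _ _).trans (add_le_add (hδ t ht) ?_)
  rw [← NNReal.val_eq_coe, ← abs_of_nonneg K.2, ← abs_mul, ← intervalIntegral.integral_const_mul]
  refine intervalIntegral.norm_integral_le_abs_of_norm_le
    (ae_restrict_of_forall_mem measurableSet_uIoc fun s hs ↦ ?_)
    (((hw.continuousOn.sub hw'.continuousOn).mono hsub).norm.const_smul
      (K : ℝ)).intervalIntegrable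
  have hs' := hsub (uIoc_subset_uIcc hs)
  simpa [abs_of_nonneg] using hK s hs'

/-- Mild solutions are unique on intervals. -/
theorem IsMildSolution.eqOn {g : ℝ → E → E} {φ : E} {w w' : ℝ → E} {J : Set ℝ}
    (hg : IsLocallyLipschitzField g) (hJ : J.OrdConnected) (h0 : (0 : ℝ) ∈ J)
    (hw : IsMildSolution g φ J w) (hw' : IsMildSolution g φ J w') : EqOn w w' J := by
  intro T hT
  have hsub := uIcc_zero_subset hJ h0 hT
  obtain ⟨R, hR⟩ := (isCompact_uIcc.image_of_continuousOn
    (hw.continuousOn.mono hsub)).isBounded.exists_norm_le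
  obtain ⟨R', hR'⟩ := (isCompact_uIcc.image_of_continuousOn
    (hw'.continuousOn.mono hsub)).isBounded.exists_norm_le
  obtain ⟨K, hK⟩ := hg.lipschitz (max R R')
  have := IsMildSolution.norm_sub_le (δ := 0) (K := K) hg.continuous hg.continuous
    (hw.mono hsub) (hw'.mono hsub) (fun s hs ↦ (hK s).norm_sub_le
      (mem_closedBall_zero_iff.2 ((hR _ (mem_image_of_mem _ hs)).trans (le_max_left _ _)))
      (mem_closedBall_zero_iff.2 ((hR' _ (mem_image_of_mem _ hs)).trans (le_max_right _ _))))
    (fun t _ ↦ by simp)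
  rw [zero_mul] at this
  exact sub_eq_zero.mp (norm_le_zero_iff.mp this)

/-- The radial retraction onto the closed ball of radius `R`. -/
def radialRetraction (R : ℝ) (x : E) : E := (R / max R ‖x‖) • x

theorem radialRetraction_of_le {R : ℝ} (hR : 0 < R) {x : E} (hx : ‖x‖ ≤ R) :
    radialRetraction R x = x := by
  rw [radialRetraction, max_eq_left hx, div_self hR.ne', one_smul]

theorem norm_radialRetraction_le {R : ℝ} (hR : 0 < R) (x : E) : ‖radialRetraction R x‖ ≤ R := by
  have hm : 0 < max R ‖x‖ := lt_max_of_lt_left hR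
  rw [radialRetraction, norm_smul, Real.norm_of_nonneg (by positivity), div_mul_eq_mul_div,
    div_le_iff₀ hm]
  exact mul_le_mul_of_nonneg_left (le_max_right _ _) hR.le

theorem lipschitzWith_radialRetraction {R : ℝ} (hR : 0 < R) :
    LipschitzWith 2 (radialRetraction R : E → E) := by
  refine LipschitzWith.of_dist_le_mul fun x y ↦ ?_
  rw [dist_eq_norm, dist_eq_norm]
  have hx : 0 < max R ‖x‖ := lt_max_of_lt_left hR
  have hy : 0 < max R ‖y‖ := lt_max_of_lt_left hR
  have e : radialRetraction R x - radialRetraction R y =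
      (R / max R ‖x‖) • (x - y) + (R / max R ‖x‖ - R / max R ‖y‖) • y := by
    simp only [radialRetraction, smul_sub, sub_smul]; abel
  have h1 : R / max R ‖x‖ ≤ 1 := (div_le_one hx).2 (le_max_left _ _)
  have h2 : ‖y‖ / max R ‖y‖ ≤ 1 := (div_le_one hy).2 (le_max_right _ _)
  have h3 : |max R ‖y‖ - max R ‖x‖| ≤ ‖x - y‖ := by
    refine (abs_max_sub_max_le_max _ _ _ _).trans ?_
    rw [sub_self, abs_zero, max_eq_right (abs_nonneg _), norm_sub_rev]
    exact abs_norm_sub_norm_le _ _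
  have h4 : ‖(R / max R ‖x‖ - R / max R ‖y‖) • y‖ =
      (R / max R ‖x‖) * (‖y‖ / max R ‖y‖) * |max R ‖y‖ - max R ‖x‖| := by
    rw [norm_smul, Real.norm_eq_abs, div_sub_div _ _ hx.ne' hy.ne',
      show R * max R ‖y‖ - max R ‖x‖ * R = R * (max R ‖y‖ - max R ‖x‖) by ring, abs_div, abs_mul,
      abs_of_pos hR, abs_of_pos (mul_pos hx hy)]
    field_simp
  rw [e]
  refine (norm_add_le _ _).trans ?_
  rw [h4, norm_smul, Real.norm_of_nonneg (by positivity)]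
  have a1 : R / max R ‖x‖ * ‖x - y‖ ≤ ‖x - y‖ := mul_le_of_le_one_left (norm_nonneg _) h1
  have a2 : R / max R ‖x‖ * (‖y‖ / max R ‖y‖) * |max R ‖y‖ - max R ‖x‖| ≤ ‖x - y‖ :=
    (mul_le_of_le_one_left (abs_nonneg _) (mul_le_one₀ h1 (by positivity) h2)).trans h3
  norm_num
  linarith

/-- Precomposing with the radial retraction makes a locally Lipschitz field globally Lipschitz. -/
theorem lipschitzWith_comp_radialRetraction {f : E → E} {R : ℝ} (hR : 0 < R) {K : ℝ≥0}
    (hf : LipschitzOnWith K f (closedBall 0 R)) :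
    LipschitzWith (K * 2) fun x ↦ f (radialRetraction R x) := by
  rw [← lipschitzOnWith_univ]
  exact hf.comp (lipschitzWith_radialRetraction hR).lipschitzOnWith fun x _ ↦
    mem_closedBall_zero_iff.2 (norm_radialRetraction_le hR x)

variable [CompleteSpace E]

/-- The truncation of a locally Lipschitz field to a ball has a global mild solution. -/
theorem exists_isMildSolution_truncation {g : ℝ → E → E} (hg : IsLocallyLipschitzField g) (φ : E)
    {R : ℝ} (hR : 0 < R) (M : ℝ) :
    ∃ w, IsMildSolution (fun s x ↦ g s (radialRetraction R x)) φ (Icc (-M) M) w := by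
  rcases lt_or_ge M 0 with hM | hM
  · rw [Icc_eq_empty (by linarith)]
    exact ⟨0, continuousOn_empty _, fun t ht ↦ ht.elim⟩
  obtain ⟨K, hK⟩ := hg.lipschitz R
  obtain ⟨B, hB⟩ := hg.bounded R
  have hball : ∀ x, radialRetraction R x ∈ closedBall (0 : E) R := fun x ↦
    mem_closedBall_zero_iff.2 (norm_radialRetraction_le hR x)
  have hB0 : 0 ≤ B := (norm_nonneg _).trans (hB 0 _ (hball 0))
  lift B to ℝ≥0 using hB0
  lift M to ℝ≥0 using hM
  have h0 : (0 : ℝ) ∈ Icc (-M : ℝ) M := ⟨neg_nonpos.2 M.2, M.2⟩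
  have hc : Continuous (Function.uncurry fun s x ↦ g s (radialRetraction R x)) :=
    hg.continuous.comp (continuous_fst.prodMk
      ((lipschitzWith_radialRetraction hR).continuous.comp continuous_snd))
  have hp : IsPicardLindelof (fun s x ↦ g s (radialRetraction R x))
      (⟨0, h0⟩ : Icc (-M : ℝ) M) φ (B * M) 0 B (K * 2) :=
    { lipschitzOnWith := fun t _ ↦
        (lipschitzWith_comp_radialRetraction hR (hK t)).lipschitzOnWith
      continuousOn := fun x _ ↦ (hc.comp (continuous_id.prodMk continuous_const)).continuousOn
      norm_le := fun t _ x _ ↦ hB t _ (hball x)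
      mul_max_le := by simp }
  obtain ⟨w, hw⟩ := ODE.FunSpace.exists_isFixedPt_next hp (mem_closedBall_self le_rfl)
  refine ⟨w.compProj, w.continuous_compProj.continuousOn, fun t ht ↦ ?_⟩
  nth_rw 1 [← hw]
  rw [ODE.FunSpace.compProj_apply, ODE.FunSpace.next_apply, projIcc_of_mem _ ht]
  rfl

end MildSolution

/-! ### Averaging -/

section Averaging

variable {E : Type*} [NormedAddCommGroup E] [NormedSpace ℝ E] [CompleteSpace E]

/-- A continuous function that is periodic in the first variable is bounded, uniformly in that
variable, for the second one in a compact set. -/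
theorem exists_bound_of_periodic {X F : Type*} [TopologicalSpace X] [NormedAddCommGroup F]
    {a : ℝ → X → F} (ha : Continuous (Function.uncurry a)) {p : ℝ} (hp : 0 < p)
    (hper : ∀ τ s, a (τ + p) s = a τ s) {S : Set X} (hS : IsCompact S) :
    ∃ B : ℝ, ∀ τ, ∀ s ∈ S, ‖a τ s‖ ≤ B := by
  obtain ⟨B, hB⟩ := ((isCompact_Icc (a := (0 : ℝ)) (b := p)).prod hS).exists_bound_of_continuousOn
    ha.continuousOn
  refine ⟨B, fun τ s hs ↦ ?_⟩
  have h1 : Function.Periodic a p := fun τ ↦ funext fun s ↦ hper τ s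
  obtain ⟨τ', hτ', e⟩ := h1.exists_mem_Ico₀ hp τ
  rw [e]
  exact hB (τ', s) ⟨Ico_subset_Icc_self hτ', hs⟩

/-- A continuous function that is periodic in the first variable is uniformly continuous in the
second one on compact intervals, uniformly in the first. -/
theorem exists_modulus_of_periodic {F : Type*} [NormedAddCommGroup F] {a : ℝ → ℝ → F}
    (ha : Continuous (Function.uncurry a)) {p : ℝ} (hp : 0 < p) (hper : ∀ τ s, a (τ + p) s = a τ s)
    (M : ℝ) {η : ℝ} (hη : 0 < η) :
    ∃ ρ > 0, ∀ τ, ∀ s ∈ Icc (-M) M, ∀ s' ∈ Icc (-M) M, |s - s'| < ρ →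
      ‖a τ s - a τ s'‖ < η := by
  have huc := ((isCompact_Icc (a := (0 : ℝ)) (b := p)).prod
    (isCompact_Icc (a := -M) (b := M))).uniformContinuousOn_of_continuous ha.continuousOn
  rw [Metric.uniformContinuousOn_iff] at huc
  obtain ⟨ρ, hρ, h⟩ := huc η hη
  refine ⟨ρ, hρ, fun τ s hs s' hs' hss ↦ ?_⟩
  have h1 : Function.Periodic a p := fun τ ↦ funext fun s ↦ hper τ s
  obtain ⟨τ', hτ', e⟩ := h1.exists_mem_Ico₀ hp τ
  rw [e, ← dist_eq_norm]
  refine h (τ', s) ⟨Ico_subset_Icc_self hτ', hs⟩ (τ', s') ⟨Ico_subset_Icc_self hτ', hs'⟩ ?_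
  rw [Prod.dist_eq, dist_self, max_eq_right dist_nonneg, Real.dist_eq]
  exact hss

/-- Replacing a function by its average over a window of length `q` changes its primitive by
`O(q)`; the average is written on the inside by Fubini's theorem. -/
theorem norm_smul_integral_sub_integral_window_le {f : ℝ → E} (hf : Continuous f) {M B q t : ℝ}
    (hq : 0 ≤ q) (ht : |t| ≤ M) (hB : ∀ s ∈ Icc (-(M + q)) (M + q), ‖f s‖ ≤ B) :
    ‖q • (∫ s in (0 : ℝ)..t, f s) - ∫ s in (0 : ℝ)..t, ∫ σ in (0 : ℝ)..q, f (s + σ)‖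
      ≤ 2 * B * q * q := by
  have hcont : Continuous (Function.uncurry fun s σ : ℝ ↦ f (s + σ)) :=
    hf.comp (continuous_fst.add continuous_snd)
  have hii : ∀ a b, IntervalIntegrable f volume a b := fun a b ↦ hf.intervalIntegrable a b
  have hM := abs_le.1 ht
  rw [intervalIntegral_intervalIntegral_swap
    ((hcont.continuousOn.integrableOn_compact (isCompact_uIcc.prod isCompact_uIcc)).mono_set
      (prod_mono uIoc_subset_uIcc uIoc_subset_uIcc))]
  have e1 : q • (∫ s in (0 : ℝ)..t, f s) = ∫ _ in (0 : ℝ)..q, ∫ s in (0 : ℝ)..t, f s := by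
    rw [intervalIntegral.integral_const, sub_zero]
  rw [e1, ← intervalIntegral.integral_sub
    (continuous_const.intervalIntegrable _ _)
    ((intervalIntegral.continuous_parametric_intervalIntegral_of_continuous'
      (f := fun σ s ↦ f (s + σ)) (hcont.comp continuous_swap) 0 t).intervalIntegrable _ _)]
  have key : ∀ σ ∈ uIoc 0 q,
      ‖(∫ s in (0 : ℝ)..t, f s) - ∫ s in (0 : ℝ)..t, f (s + σ)‖ ≤ 2 * B * q := by
    intro σ hσ
    rw [uIoc_of_le hq] at hσ
    have e2 : (∫ s in (0 : ℝ)..t, f s) - ∫ s in (0 : ℝ)..t, f (s + σ) =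
        (∫ s in (0 : ℝ)..σ, f s) - ∫ s in t..(t + σ), f s := by
      rw [intervalIntegral.integral_comp_add_right f, zero_add,
        ← intervalIntegral.integral_add_adjacent_intervals (hii 0 σ) (hii σ t),
        ← intervalIntegral.integral_add_adjacent_intervals (hii σ t) (hii t (t + σ))]
      abel
    have b1 : ‖∫ s in (0 : ℝ)..σ, f s‖ ≤ B * |σ - 0| :=
      intervalIntegral.norm_integral_le_of_norm_le_const fun s hs ↦ by
        rw [uIoc_of_le hσ.1.le] at hs
        exact hB s ⟨by linarith [hs.1], by linarith [hs.2, hσ.2]⟩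
    have b2 : ‖∫ s in t..(t + σ), f s‖ ≤ B * |t + σ - t| :=
      intervalIntegral.norm_integral_le_of_norm_le_const fun s hs ↦ by
        rw [uIoc_of_le (by linarith [hσ.1])] at hs
        exact hB s ⟨by linarith [hs.1], by linarith [hs.2, hσ.2]⟩
    have hB0 : 0 ≤ B := (norm_nonneg _).trans (hB t ⟨by linarith, by linarith⟩)
    rw [sub_zero, abs_of_pos hσ.1] at b1
    rw [add_sub_cancel_left, abs_of_pos hσ.1] at b2
    rw [e2]
    refine (norm_sub_le _ _).trans ?_
    nlinarith [mul_le_mul_of_nonneg_left hσ.2 hB0]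
  have := intervalIntegral.norm_integral_le_of_norm_le_const key
  rwa [sub_zero, abs_of_nonneg hq] at this

/-- The averaging lemma: if `a τ s` is periodic with mean zero in the fast variable `τ`, then the
primitive of `a (s / ε) s` tends to `0` as `ε → 0`, uniformly on bounded intervals. -/
theorem exists_norm_integral_oscillating_le {a : ℝ → ℝ → E} (ha : Continuous (Function.uncurry a))
    {p : ℝ} (hp : 0 < p) (hper : ∀ τ s, a (τ + p) s = a τ s)
    (hmean : ∀ s, ∫ τ in (0 : ℝ)..p, a τ s = 0) (M : ℝ) {δ : ℝ} (hδ : 0 < δ) :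
    ∃ ε₀ > 0, ∀ ε, 0 < ε → ε < ε₀ → ∀ t, |t| ≤ M → ‖∫ s in (0 : ℝ)..t, a (s / ε) s‖ ≤ δ := by
  rcases lt_or_ge M 0 with hM | hM
  · exact ⟨1, one_pos, fun ε _ _ t ht ↦ by linarith [abs_nonneg t]⟩
  obtain ⟨B, hB⟩ := exists_bound_of_periodic ha hp hper (isCompact_Icc (a := -(M + 1)) (b := M + 1))
  set η := δ / (2 * (M + 1)) with hη
  obtain ⟨ρ, hρ, hω⟩ := exists_modulus_of_periodic ha hp hper (M + 1) (η := η) (by positivity)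
  have hB0 : 0 ≤ B := (norm_nonneg _).trans (hB 0 0 ⟨by linarith, by linarith⟩)
  -- The window of length `q = ε p` is shorter than `ρ`, and the boundary term `2 B q` is below
  -- `δ / 2`.
  refine ⟨min (min 1 ρ) (δ / (4 * (B + 1))) / p, by positivity, fun ε hε hlt t ht ↦ ?_⟩
  set q := ε * p with hq
  have hqpos : 0 < q := by positivity
  rw [lt_div_iff₀ hp, lt_min_iff, lt_min_iff] at hlt
  obtain ⟨⟨hq1, hqρ⟩, hqδ⟩ := hlt
  have hf : Continuous fun s ↦ a (s / ε) s :=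
    ha.comp ((continuous_id.div_const ε).prodMk continuous_id)
  have h1 := norm_smul_integral_sub_integral_window_le hf hqpos.le ht (B := B) fun s hs ↦
    hB _ s ⟨by linarith [hs.1], by linarith [hs.2]⟩
  have hMt := abs_le.1 ht
  -- Freezing the slow variable over one period, the integral over the period vanishes.
  have h2 : ∀ s ∈ uIoc 0 t, ‖∫ σ in (0 : ℝ)..q, a ((s + σ) / ε) (s + σ)‖ ≤ η * q := by
    intro s hs
    have hs' : -M ≤ s ∧ s ≤ M := by
      have := uIoc_subset_uIcc hs
      rw [mem_uIcc] at this
      rcases this with h | h <;> constructor <;> linarith [h.1, h.2]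
    have hz : ∫ σ in (0 : ℝ)..q, a ((s + σ) / ε) s = 0 := by
      have hP : Function.Periodic (fun τ ↦ a τ s) p := fun τ ↦ hper τ s
      have e := intervalIntegral.integral_comp_div (fun τ ↦ a τ s) hε.ne' (a := s) (b := s + q)
      rw [show (s + q) / ε = s / ε + p by rw [hq]; field_simp, hP.intervalIntegral_add_eq _ 0,
        zero_add, hmean, smul_zero] at e
      rw [intervalIntegral.integral_comp_add_left (fun σ ↦ a (σ / ε) s), add_zero]
      exact e
    have c1 : Continuous fun σ ↦ a ((s + σ) / ε) (s + σ) :=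
      hf.comp (continuous_const.add continuous_id)
    have c2 : Continuous fun σ ↦ a ((s + σ) / ε) s :=
      ha.comp (((continuous_const.add continuous_id).div_const ε).prodMk continuous_const)
    rw [← sub_zero (∫ σ in (0 : ℝ)..q, _), ← hz, ← intervalIntegral.integral_sub
      (c1.intervalIntegrable _ _) (c2.intervalIntegrable _ _)]
    have := intervalIntegral.norm_integral_le_of_norm_le_const (a := 0) (b := q) (C := η)
      (f := fun σ ↦ a ((s + σ) / ε) (s + σ) - a ((s + σ) / ε) s) fun σ hσ ↦ by
        rw [uIoc_of_le hqpos.le] at hσ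
        refine (hω _ _ ⟨by linarith [hσ.1], by linarith [hσ.2]⟩ _
          ⟨by linarith, by linarith⟩ ?_).le
        rw [add_sub_cancel_left, abs_of_pos hσ.1]
        linarith [hσ.2]
    rwa [sub_zero, abs_of_pos hqpos] at this
  have h3 := intervalIntegral.norm_integral_le_of_norm_le_const h2
  rw [sub_zero] at h3
  have h4 : q * ‖∫ s in (0 : ℝ)..t, a (s / ε) s‖ ≤ 2 * B * q * q + η * q * |t| := by
    rw [← abs_of_pos hqpos, ← Real.norm_eq_abs, ← norm_smul, Real.norm_of_nonneg hqpos.le]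
    refine (norm_le_norm_sub_add _ _).trans (add_le_add h1 h3)
  have h5 : ‖∫ s in (0 : ℝ)..t, a (s / ε) s‖ ≤ 2 * B * q + η * |t| :=
    le_of_mul_le_mul_left (by linarith) hqpos
  have h6 : η * |t| ≤ δ / 2 := by
    rw [hη, div_mul_eq_mul_div, div_le_iff₀ (by positivity)]
    nlinarith
  have h7 : 2 * B * q ≤ δ / 2 := by
    rw [lt_div_iff₀ (by positivity)] at hqδ
    nlinarith
  linarith

/-- The averaging principle: if `D` is periodic and the average over one period of `ψ ∘ D` equals
the average of `ψ` over `[0, 1]`, then solutions for the field `h (D (s / ε))` converge to solutions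
for the averaged field `∫₀¹ h r dr`, as long as the latter exist. -/
theorem exists_isMildSolution_near_averaged {h : ℝ → ℝ → E → E} {g₀ : ℝ → E → E}
    (hc : Continuous fun q : ℝ × ℝ × E ↦ h q.1 q.2.1 q.2.2)
    (hL : ∀ R : ℝ, ∃ K : ℝ≥0, ∀ r t, LipschitzOnWith K (h r t) (closedBall 0 R))
    (hB : ∀ R : ℝ, ∃ B : ℝ, ∀ r t, ∀ x ∈ closedBall (0 : E) R, ‖h r t x‖ ≤ B)
    (hg₀ : Continuous (Function.uncurry g₀))
    (hav : ∀ s x, g₀ s x = ∫ r in (0 : ℝ)..1, h r s x)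
    {D : ℝ → ℝ} (hD : Continuous D) {p : ℝ} (hp : 0 < p) (hper : Function.Periodic D p)
    (hDav : ∀ ψ : ℝ → E, Continuous ψ →
      ∫ τ in (0 : ℝ)..p, ψ (D τ) = p • ∫ r in (0 : ℝ)..1, ψ r)
    {φ : E} {M : ℝ} (hM : 0 ≤ M) {w : ℝ → E} (hw : IsMildSolution g₀ φ (Icc (-M) M) w)
    {δ : ℝ} (hδ : 0 < δ) :
    ∃ ε₀ > 0, ∀ ε, 0 < ε → ε < ε₀ → ∃ w', IsMildSolution (fun s x ↦ h (D (s / ε)) s x) φ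
      (Icc (-M) M) w' ∧ ∀ t ∈ Icc (-M) M, ‖w' t - w t‖ ≤ δ := by
  have hMM : -M ≤ M := by linarith
  obtain ⟨R₀, hR₀⟩ := (isCompact_Icc.image_of_continuousOn hw.continuousOn).isBounded.exists_norm_le
  have hR₀' : ∀ t ∈ Icc (-M) M, ‖w t‖ ≤ R₀ := fun t ht ↦ hR₀ _ (mem_image_of_mem _ ht)
  set R := R₀ + δ with hR
  have hRpos : 0 < R := by
    have := (norm_nonneg _).trans (hR₀' 0 ⟨by linarith, hM⟩)
    linarith
  obtain ⟨K, hK⟩ := hL R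
  -- The radial retraction is `2`-Lipschitz, so Grönwall's inequality for the truncated field loses
  -- at most the factor `exp (2 K M)`.
  set δ' := δ * Real.exp (-((K * 2 : ℝ≥0) * M)) with hδ'
  -- The oscillating part of the field along a continuous extension of `w`.
  set z : ℝ → E := IccExtend hMM ((Icc (-M) M).domRestrict w) with hz
  have hzc : Continuous z :=
    (continuousOn_iff_continuous_domRestrict.mp hw.continuousOn).Icc_extend'
  have hzw : ∀ t ∈ Icc (-M) M, z t = w t := fun t ht ↦ by
    rw [hz, IccExtend_of_mem _ _ ht, domRestrict_apply]
  obtain ⟨ε₀, hε₀, hosc⟩ := exists_norm_integral_oscillating_le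
    (a := fun τ s ↦ h (D τ) s (z s) - g₀ s (z s)) (p := p)
    ((hc.comp ((hD.comp continuous_fst).prodMk
      (continuous_snd.prodMk (hzc.comp continuous_snd)))).sub
      (hg₀.comp (continuous_snd.prodMk (hzc.comp continuous_snd)))) hp
    (fun τ s ↦ by simp only [hper τ]) (fun s ↦ by
      have c : Continuous fun r ↦ h r s (z s) := 
        hc.comp (continuous_id.prodMk (continuous_const (y := (s, z s))))
      have cD : Continuous fun τ ↦ h (D τ) s (z s) := c.comp hD
      rw [intervalIntegral.integral_sub (cD.intervalIntegrable _ _)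
        (continuous_const.intervalIntegrable _ _), hDav _ c, intervalIntegral.integral_const, hav,
        sub_zero, sub_self])
    M (δ := δ') (by positivity)
  refine ⟨ε₀, hε₀, fun ε hε hεlt ↦ ?_⟩
  have hDε : Continuous fun s ↦ D (s / ε) := hD.comp (continuous_id.div_const ε)
  have hg : IsLocallyLipschitzField fun s x ↦ h (D (s / ε)) s x :=
    { continuous := hc.comp ((hDε.comp continuous_fst).prodMk
        (continuous_fst.prodMk continuous_snd))
      lipschitz := fun R ↦ (hL R).imp fun K hK t ↦ hK _ t
      bounded := fun R ↦ (hB R).imp fun B hB t ↦ hB _ t }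
  obtain ⟨w', hw'⟩ := exists_isMildSolution_truncation hg φ hRpos M
  have hgR : Continuous (Function.uncurry fun s x ↦ h (D (s / ε)) s (radialRetraction R x)) :=
    hg.continuous.comp (continuous_fst.prodMk
      ((lipschitzWith_radialRetraction hRpos).continuous.comp continuous_snd))
  have hclose : ∀ t ∈ Icc (-M) M, ‖w' t - w t‖ ≤ δ := by
    intro T hT
    have hsub : uIcc 0 T ⊆ Icc (-M) M := uIcc_zero_subset ordConnected_Icc ⟨by linarith, hM⟩ hT
    have := IsMildSolution.norm_sub_le (δ := δ') (K := K * 2) hgR hg₀ (hw'.mono hsub) (hw.mono hsub)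
      (fun s _ ↦ (lipschitzWith_comp_radialRetraction hRpos (hK _ s)).norm_sub_le _ _)
      (fun t ht ↦ by
        have ht' := hsub ht
        refine le_of_eq_of_le (congrArg norm (intervalIntegral.integral_congr fun s hs ↦ ?_))
          (hosc ε hε hεlt t (abs_le.2 ht'))
        have hs' := uIcc_zero_subset ordConnected_Icc ⟨by linarith, hM⟩ ht' hs
        simp only [hzw s hs']
        rw [radialRetraction_of_le hRpos (by linarith [hR₀' s hs'])])
    refine this.trans ?_
    rw [hδ', mul_assoc, ← Real.exp_add]
    refine mul_le_of_le_one_right hδ.le (Real.exp_le_one_iff.2 ?_)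
    have := mul_le_mul_of_nonneg_left (abs_le.2 hT) (K * 2 : ℝ≥0).coe_nonneg
    linarith
  -- The solution of the truncated equation stays where the truncation is inactive.
  refine ⟨w', ⟨hw'.continuousOn, fun t ht ↦ ?_⟩, hclose⟩
  rw [hw'.integral_eq t ht]
  congr 1
  refine intervalIntegral.integral_congr fun s hs ↦ ?_
  have hs' := uIcc_zero_subset ordConnected_Icc ⟨by linarith, hM⟩ ht hs
  have := norm_le_norm_add_norm_sub (w s) (w' s)
  rw [norm_sub_rev] at this
  rw [radialRetraction_of_le hRpos (by linarith [hclose s hs', hR₀' s hs'])]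

end Averaging

/-! ### Groups of isometries and the interaction picture -/

section IsometryGroup

variable {E : Type*} [NormedAddCommGroup E] [NormedSpace ℂ E]

/-- A strongly continuous one-parameter group of linear isometries. -/
structure IsIsometryGroup (U : ℝ → E →ₗᵢ[ℂ] E) : Prop where
  zero : ∀ x, U 0 x = x
  add : ∀ s t x, U (s + t) x = U s (U t x)
  continuous : ∀ x, Continuous fun t ↦ U t x

variable {U : ℝ → E →ₗᵢ[ℂ] E}

theorem norm_isometry_sub (t : ℝ) (f g : E) : ‖U t f - U t g‖ = ‖f - g‖ := by
  rw [← map_sub, (U t).norm_map]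

theorem mem_closedBall_isometry {R : ℝ} {f : E} (t : ℝ) (hf : f ∈ closedBall (0 : E) R) :
    U t f ∈ closedBall (0 : E) R := by
  rw [mem_closedBall_zero_iff] at hf ⊢
  rwa [(U t).norm_map]

namespace IsIsometryGroup

theorem neg_apply (hU : IsIsometryGroup U) (t : ℝ) (f : E) : U (-t) (U t f) = f := by
  rw [← hU.add, neg_add_cancel, hU.zero]

theorem apply_neg (hU : IsIsometryGroup U) (t : ℝ) (f : E) : U t (U (-t) f) = f := by
  rw [← hU.add, add_neg_cancel, hU.zero]

theorem continuous_uncurry (hU : IsIsometryGroup U) : Continuous fun p : ℝ × E ↦ U p.1 p.2 :=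
  continuous_prod_of_continuous_lipschitzWith' _ 1
    (fun t ↦ (U t).isometry.lipschitz) hU.continuous

theorem continuous_comp (hU : IsIsometryGroup U) {X : Type*} [TopologicalSpace X] {a : X → ℝ}
    {b : X → E} (ha : Continuous a) (hb : Continuous b) : Continuous fun x ↦ U (a x) (b x) :=
  hU.continuous_uncurry.comp (ha.prodMk hb)

theorem continuousOn_comp (hU : IsIsometryGroup U) {X : Type*} [TopologicalSpace X] {a : X → ℝ}
    {b : X → E} {J : Set X} (ha : Continuous a) (hb : ContinuousOn b J) :
    ContinuousOn (fun x ↦ U (a x) (b x)) J :=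
  hU.continuous_uncurry.comp_continuousOn (ha.continuousOn.prodMk hb)

end IsIsometryGroup

theorem continuous_of_lipschitzOnWith_closedBall {E F : Type*} [SeminormedAddCommGroup E]
    [PseudoEMetricSpace F] {f : E → F}
    (h : ∀ R : ℝ, ∃ K : ℝ≥0, LipschitzOnWith K f (closedBall 0 R)) : Continuous f := by
  refine continuous_iff_continuousAt.2 fun x ↦ ?_
  obtain ⟨K, hK⟩ := h (‖x‖ + 1)
  refine hK.continuousOn.continuousAt (closedBall_mem_nhds_of_mem ?_)
  rw [mem_ball_zero_iff]
  linarith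

/-- The conjugated nonlinearity `U_r⁻¹ ∘ N ∘ U_r`. -/
def conjMap (U : ℝ → E →ₗᵢ[ℂ] E) (N : E → E) (r : ℝ) (f : E) : E := U (-r) (N (U r f))

/-- The averaged nonlinearity `∫₀¹ U_r⁻¹ ∘ N ∘ U_r dr`. -/
def avgMap (U : ℝ → E →ₗᵢ[ℂ] E) (N : E → E) (f : E) : E := ∫ r in (0 : ℝ)..1, conjMap U N r f

section Nonlinearity

variable {N : E → E}

theorem exists_lipschitzOnWith_conjMap
    (hN : ∀ R : ℝ, ∃ K : ℝ≥0, LipschitzOnWith K N (closedBall 0 R)) (R : ℝ) :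
    ∃ K : ℝ≥0, ∀ r, LipschitzOnWith K (conjMap U N r) (closedBall 0 R) := by
  obtain ⟨K, hK⟩ := hN R
  refine ⟨K, fun r ↦ LipschitzOnWith.of_dist_le_mul fun f hf g hg ↦ ?_⟩
  rw [dist_eq_norm, dist_eq_norm, conjMap, conjMap, norm_isometry_sub,
    ← norm_isometry_sub (U := U) r f g]
  exact hK.norm_sub_le (mem_closedBall_isometry r hf) (mem_closedBall_isometry r hg)

theorem exists_norm_conjMap_le
    (hN : ∀ R : ℝ, ∃ K : ℝ≥0, LipschitzOnWith K N (closedBall 0 R)) (R : ℝ) :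
    ∃ B : ℝ, ∀ r, ∀ f ∈ closedBall (0 : E) R, ‖conjMap U N r f‖ ≤ B := by
  obtain ⟨K, hK⟩ := hN R
  rcases lt_or_ge R 0 with hR | hR
  · exact ⟨0, fun r f hf ↦ by simp [closedBall_eq_empty.2 hR] at hf⟩
  refine ⟨K * R + ‖N 0‖, fun r f hf ↦ ?_⟩
  have h1 := hK.norm_sub_le (mem_closedBall_isometry (U := U) r hf) (y := 0) (by simpa using hR)
  rw [mem_closedBall_zero_iff] at hf
  rw [sub_zero, (U r).norm_map] at h1
  rw [conjMap, (U (-r)).norm_map]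
  have h2 := norm_le_norm_sub_add (N (U r f)) (N 0)
  have h3 := mul_le_mul_of_nonneg_left hf K.coe_nonneg
  linarith

theorem continuous_conjMap_comp
    (hN : ∀ R : ℝ, ∃ K : ℝ≥0, LipschitzOnWith K N (closedBall 0 R)) (hU : IsIsometryGroup U)
    {X : Type*} [TopologicalSpace X] {a : X → ℝ} {b : X → E}
    (ha : Continuous a) (hb : Continuous b) : Continuous fun x ↦ conjMap U N (a x) (b x) :=
  hU.continuous_comp ha.neg ((continuous_of_lipschitzOnWith_closedBall hN).comp
    (hU.continuous_comp ha hb))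

theorem intervalIntegrable_conjMap
    (hN : ∀ R : ℝ, ∃ K : ℝ≥0, LipschitzOnWith K N (closedBall 0 R)) (hU : IsIsometryGroup U)
    (f : E) (a b : ℝ) :
    IntervalIntegrable (fun r ↦ conjMap U N r f) volume a b :=
  (continuous_conjMap_comp hN hU continuous_id continuous_const).intervalIntegrable a b

theorem isLocallyLipschitzField_conjMap
    (hN : ∀ R : ℝ, ∃ K : ℝ≥0, LipschitzOnWith K N (closedBall 0 R)) (hU : IsIsometryGroup U)
    {ρ : ℝ → ℝ} (hρ : Continuous ρ) :
    IsLocallyLipschitzField fun s f ↦ conjMap U N (ρ s) f where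
  continuous := continuous_conjMap_comp hN hU (hρ.comp continuous_fst) continuous_snd
  lipschitz R := (exists_lipschitzOnWith_conjMap hN R).imp fun _ hK _ ↦ hK _
  bounded R := (exists_norm_conjMap_le hN R).imp fun _ hB _ ↦ hB _

theorem isLocallyLipschitzField_avgMap
    (hN : ∀ R : ℝ, ∃ K : ℝ≥0, LipschitzOnWith K N (closedBall 0 R)) (hU : IsIsometryGroup U)
    : IsLocallyLipschitzField fun _ f ↦ avgMap U N f := by
  have hL : ∀ R : ℝ, ∃ K : ℝ≥0, LipschitzOnWith K (avgMap U N) (closedBall 0 R) := by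
    intro R
    obtain ⟨K, hK⟩ := exists_lipschitzOnWith_conjMap (U := U) hN R
    refine ⟨K, LipschitzOnWith.of_dist_le_mul fun f hf g hg ↦ ?_⟩
    rw [dist_eq_norm, dist_eq_norm, avgMap, avgMap, ← intervalIntegral.integral_sub
      (intervalIntegrable_conjMap hN hU f 0 1) (intervalIntegrable_conjMap hN hU g 0 1)]
    have := intervalIntegral.norm_integral_le_of_norm_le_const (a := 0) (b := 1)
      fun r _ ↦ (hK r).norm_sub_le hf hg
    simpa using this
  refine ⟨(continuous_of_lipschitzOnWith_closedBall hL).comp continuous_snd,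
    fun R ↦ (hL R).imp fun K hK _ ↦ hK, fun R ↦ ?_⟩
  obtain ⟨B, hB⟩ := exists_norm_conjMap_le (U := U) hN R
  refine ⟨B, fun _ f hf ↦ ?_⟩
  have := intervalIntegral.norm_integral_le_of_norm_le_const (a := 0) (b := 1)
    fun r _ ↦ hB r f hf
  simpa [avgMap] using this

end Nonlinearity

/-- The vector field in the interaction picture: the equation `i v' + d A v + G(t, v) = 0`, where
`U t = exp (i t A)`, becomes `w' = interactionField U d G t w` for `w t = U (t d)⁻¹ (v t)`. -/
def interactionField (U : ℝ → E →ₗᵢ[ℂ] E) (d : ℝ) (G : ℝ → E → E) (s : ℝ) (x : E) : E :=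
  Complex.I • U (-(s * d)) (G s (U (s * d) x))

theorem IsLocallyLipschitzField.interactionField (hU : IsIsometryGroup U) {d : ℝ}
    {G : ℝ → E → E} (hG : IsLocallyLipschitzField G) :
    IsLocallyLipschitzField (interactionField U d G) where
  continuous := by
    have hd : Continuous fun p : ℝ × E ↦ p.1 * d := continuous_fst.mul continuous_const
    have h1 : Continuous fun p : ℝ × E ↦ G p.1 (U (p.1 * d) p.2) :=
      hG.continuous.comp (continuous_fst.prodMk (hU.continuous_comp hd continuous_snd))
    exact (hU.continuous_comp hd.neg h1).const_smul Complex.I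
  lipschitz R := by
    obtain ⟨K, hK⟩ := hG.lipschitz R
    refine ⟨K, fun s ↦ LipschitzOnWith.of_dist_le_mul fun f hf g hg ↦ ?_⟩
    rw [dist_eq_norm, dist_eq_norm, DMNLS.interactionField, DMNLS.interactionField, ← smul_sub,
      norm_smul, Complex.norm_I, one_mul, norm_isometry_sub,
      ← norm_isometry_sub (U := U) (s * d) f g]
    exact (hK s).norm_sub_le (mem_closedBall_isometry _ hf) (mem_closedBall_isometry _ hg)
  bounded R := by
    obtain ⟨B, hB⟩ := hG.bounded R
    refine ⟨B, fun s f hf ↦ ?_⟩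
    rw [DMNLS.interactionField, norm_smul, Complex.norm_I, one_mul, (U _).norm_map]
    exact hB s _ (mem_closedBall_isometry _ hf)

variable [CompleteSpace E]

/-- Duhamel's formula is equivalent to the integral equation in the interaction picture. -/
theorem duhamel_iff (hU : IsIsometryGroup U) {d t : ℝ} {G : ℝ → E → E}
    (hG : Continuous (Function.uncurry G)) {φ : E} {v : ℝ → E} (hv : ContinuousOn v (uIcc 0 t)) :
    v t = U (t * d) φ + Complex.I • ∫ s in (0 : ℝ)..t, U ((t - s) * d) (G s (v s)) ↔
      U (-(t * d)) (v t) =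
        φ + ∫ s in (0 : ℝ)..t, interactionField U d G s (U (-(s * d)) (v s)) := by
  have htd : Continuous fun t : ℝ ↦ t * d := continuous_id.mul continuous_const
  have hint : IntervalIntegrable (fun s ↦ U (-(s * d)) (G s (v s))) volume 0 t :=
    (hU.continuousOn_comp htd.neg (continuousOn_field_comp hG hv)).intervalIntegrable
  have e1 : ∫ s in (0 : ℝ)..t, interactionField U d G s (U (-(s * d)) (v s)) =
      Complex.I • ∫ s in (0 : ℝ)..t, U (-(s * d)) (G s (v s)) := by
    rw [← intervalIntegral.integral_smul]
    simp only [interactionField, hU.apply_neg]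
  have e2 : ∫ s in (0 : ℝ)..t, U ((t - s) * d) (G s (v s)) =
      U (t * d) (∫ s in (0 : ℝ)..t, U (-(s * d)) (G s (v s))) := by
    have := (U (t * d)).toContinuousLinearMap.intervalIntegral_comp_comm hint
    refine Eq.trans (intervalIntegral.integral_congr fun s _ ↦ ?_) this
    change _ = U (t * d) (U (-(s * d)) (G s (v s)))
    rw [← hU.add]
    congr 2
    ring
  rw [e1, e2, ← map_smul, ← map_add]
  constructor
  · intro h; rw [h, hU.neg_apply]
  · intro h; rw [← h, hU.apply_neg]

/-- The averaged field in the interaction picture is the average of the conjugated fields. -/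
theorem interactionField_avgMap (hU : IsIsometryGroup U) {N : E → E}
    (hN : ∀ R : ℝ, ∃ K : ℝ≥0, LipschitzOnWith K N (closedBall 0 R)) (d s : ℝ) (x : E) :
    interactionField U d (fun _ ↦ avgMap U N) s x =
      ∫ r in (0 : ℝ)..1, interactionField U d (fun _ ↦ conjMap U N r) s x := by
  have := (U (-(s * d))).toContinuousLinearMap.intervalIntegral_comp_comm
    (intervalIntegrable_conjMap hN hU (U (s * d) x) 0 1)
  simp only [interactionField]
  rw [intervalIntegral.integral_smul]
  exact congrArg _ this.symm

/-- The averaging principle for the conjugated nonlinearities, in the interaction picture. -/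
theorem exists_isMildSolution_near_avgMap (hU : IsIsometryGroup U) {N : E → E}
    (hN : ∀ R : ℝ, ∃ K : ℝ≥0, LipschitzOnWith K N (closedBall 0 R)) {d : ℝ}
    {D : ℝ → ℝ} (hD : Continuous D) {p : ℝ} (hp : 0 < p) (hper : Function.Periodic D p)
    (hDav : ∀ ψ : ℝ → E, Continuous ψ →
      ∫ τ in (0 : ℝ)..p, ψ (D τ) = p • ∫ r in (0 : ℝ)..1, ψ r)
    {φ : E} {M : ℝ} (hM : 0 ≤ M) {w : ℝ → E}
    (hw : IsMildSolution (interactionField U d fun _ ↦ avgMap U N) φ (Icc (-M) M) w)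
    {δ : ℝ} (hδ : 0 < δ) :
    ∃ ε₀ > 0, ∀ ε, 0 < ε → ε < ε₀ → ∃ w',
      IsMildSolution (interactionField U d fun s ↦ conjMap U N (D (s / ε))) φ (Icc (-M) M) w' ∧
        ∀ t ∈ Icc (-M) M, ‖w' t - w t‖ ≤ δ := by
  refine exists_isMildSolution_near_averaged
    (h := fun r s x ↦ interactionField U d (fun _ ↦ conjMap U N r) s x) ?_ (fun R ↦ ?_)
    (fun R ↦ ?_) ((isLocallyLipschitzField_avgMap hN hU).interactionField hU).continuous
    (fun s x ↦ interactionField_avgMap hU hN d s x) hD hp hper hDav hM hw hδ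
  · have hd : Continuous fun q : ℝ × ℝ × E ↦ q.2.1 * d :=
      (continuous_fst.comp continuous_snd).mul continuous_const
    exact (hU.continuous_comp hd.neg (continuous_conjMap_comp hN hU continuous_fst
      (hU.continuous_comp hd (continuous_snd.comp continuous_snd)))).const_smul Complex.I
  · obtain ⟨K, hK⟩ := exists_lipschitzOnWith_conjMap (U := U) hN R
    refine ⟨K, fun r s ↦ LipschitzOnWith.of_dist_le_mul fun f hf g hg ↦ ?_⟩
    rw [dist_eq_norm, dist_eq_norm, interactionField, interactionField, ← smul_sub,
      norm_smul, Complex.norm_I, one_mul, norm_isometry_sub,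
      ← norm_isometry_sub (U := U) (s * d) f g]
    exact (hK r).norm_sub_le (mem_closedBall_isometry _ hf) (mem_closedBall_isometry _ hg)
  · obtain ⟨B, hB⟩ := exists_norm_conjMap_le (U := U) hN R
    refine ⟨B, fun r s f hf ↦ ?_⟩
    rw [interactionField, norm_smul, Complex.norm_I, one_mul, (U _).norm_map]
    exact hB r _ (mem_closedBall_isometry _ hf)

end IsometryGroup

/-! ### The map `z ↦ |z|^α z` -/

section PowerMap

variable {V : Type*} [NormedAddCommGroup V] [InnerProductSpace ℝ V]

/-- The derivative of `z ↦ ‖z‖ ^ α • z` at `z` in the direction `h`. -/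
def powerDeriv (α : ℝ) (z h : V) : V :=
  ‖z‖ ^ α • h + (α * (‖z‖ ^ (α - 2) * inner ℝ z h)) • z

theorem hasDerivAt_norm_rpow_smul {α : ℝ} (hα : 1 < α) {f : ℝ → V} {f' : V} {x : ℝ}
    (hf : HasDerivAt f f' x) :
    HasDerivAt (fun y ↦ ‖f y‖ ^ α • f y) (powerDeriv α (f x) f') x := by
  have h1 := (hasFDerivAt_norm_rpow (f x) hα).comp_hasDerivAt x hf
  refine (h1.smul hf).congr_deriv ?_
  simp [powerDeriv, mul_assoc]

theorem continuous_powerDeriv {α : ℝ} (hα : 2 ≤ α) :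
    Continuous fun p : V × V ↦ powerDeriv α p.1 p.2 := by
  unfold powerDeriv
  have h1 : Continuous fun p : V × V ↦ ‖p.1‖ ^ α :=
    continuous_fst.norm.rpow_const fun _ ↦ Or.inr (by linarith)
  have h2 : Continuous fun p : V × V ↦ ‖p.1‖ ^ (α - 2) :=
    continuous_fst.norm.rpow_const fun _ ↦ Or.inr (by linarith)
  exact (h1.smul continuous_snd).add ((continuous_const.mul
    (h2.mul (continuous_fst.inner continuous_snd))).smul continuous_fst)

theorem rpow_sub_two_mul_sq {α a : ℝ} (hα : 2 ≤ α) (ha : 0 ≤ a) :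
    a ^ (α - 2) * (a * a) = a ^ α := by
  rw [← pow_two, ← Real.rpow_natCast, ← Real.rpow_add' ha (by norm_num; linarith)]
  norm_num

theorem rpow_sub_two_mul_self_le {α a R : ℝ} (hα : 2 ≤ α) (ha : 0 ≤ a) (haR : a ≤ R) :
    a ^ (α - 2) * a ≤ R ^ (α - 1) := by
  rw [show a ^ (α - 2) * a = a ^ (α - 1) by
    nth_rw 2 [← Real.rpow_one a]
    rw [← Real.rpow_add' ha (by linarith)]; congr 1; ring]
  exact Real.rpow_le_rpow ha haR (by linarith)

theorem abs_rpow_sub_rpow_le {α a b R : ℝ} (hα : 1 ≤ α) (ha : 0 ≤ a) (haR : a ≤ R) (hb : 0 ≤ b)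
    (hbR : b ≤ R) : |a ^ α - b ^ α| ≤ α * R ^ (α - 1) * |a - b| := by
  have hd : ∀ x ∈ Icc 0 R, HasDerivWithinAt (fun y : ℝ ↦ y ^ α) (α * x ^ (α - 1)) (Icc 0 R) x :=
    fun x _ ↦ (Real.hasDerivAt_rpow_const (Or.inr hα)).hasDerivWithinAt
  refine (convex_Icc 0 R).norm_image_sub_le_of_norm_hasDerivWithin_le hd (fun x hx ↦ ?_)
    ⟨hb, hbR⟩ ⟨ha, haR⟩
  rw [Real.norm_of_nonneg (mul_nonneg (by linarith) (Real.rpow_nonneg hx.1 _))]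
  exact mul_le_mul_of_nonneg_left (Real.rpow_le_rpow hx.1 hx.2 (by linarith)) (by linarith)

theorem norm_powerDeriv_le {α R : ℝ} (hα : 2 ≤ α) {z : V} (hz : ‖z‖ ≤ R) (h : V) :
    ‖powerDeriv α z h‖ ≤ (1 + α) * R ^ α * ‖h‖ := by
  have e : ‖z‖ ^ α ≤ R ^ α := Real.rpow_le_rpow (norm_nonneg z) hz (by linarith)
  have h1 : ‖(α * (‖z‖ ^ (α - 2) * inner ℝ z h)) • z‖ ≤ α * (‖z‖ ^ α * ‖h‖) := by
    have hp : 0 ≤ ‖z‖ ^ (α - 2) := by positivity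
    rw [norm_smul, norm_mul, norm_mul, Real.norm_of_nonneg (by linarith : 0 ≤ α),
      Real.norm_of_nonneg hp, ← rpow_sub_two_mul_sq hα (norm_nonneg z)]
    have := mul_le_mul_of_nonneg_left (mul_le_mul_of_nonneg_right (norm_inner_le_norm (𝕜 := ℝ) z h)
      (norm_nonneg z)) (mul_nonneg (by linarith : 0 ≤ α) hp)
    linarith
  rw [powerDeriv]
  refine (norm_add_le _ _).trans ?_
  rw [norm_smul, Real.norm_of_nonneg (by positivity)]
  have h2 := mul_le_mul_of_nonneg_right e (norm_nonneg h)
  have h3 := mul_le_mul_of_nonneg_left h2 (by linarith : 0 ≤ α)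
  linarith

theorem norm_rpow_smul_sub_le {α R : ℝ} (hα : 1 ≤ α) {z w : V} (hz : ‖z‖ ≤ R) (hw : ‖w‖ ≤ R) :
    ‖‖z‖ ^ α • z - ‖w‖ ^ α • w‖ ≤ (R ^ α + α * R ^ (α - 1) * R) * ‖z - w‖ := by
  have e : ‖z‖ ^ α • z - ‖w‖ ^ α • w = ‖z‖ ^ α • (z - w) + (‖z‖ ^ α - ‖w‖ ^ α) • w := by
    rw [smul_sub, sub_smul]; abel
  have hR : 0 ≤ R := (norm_nonneg z).trans hz
  have h1 := abs_rpow_sub_rpow_le hα (norm_nonneg z) hz (norm_nonneg w) hw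
  rw [e, add_mul]
  refine (norm_add_le _ _).trans (add_le_add ?_ ?_)
  · rw [norm_smul, Real.norm_of_nonneg (by positivity)]
    gcongr
  · rw [norm_smul, Real.norm_eq_abs]
    refine (mul_le_mul (h1.trans (mul_le_mul_of_nonneg_left (abs_norm_sub_norm_le z w)
      (by positivity))) hw (norm_nonneg w) (by positivity)).trans (le_of_eq (by ring))

/-- The derivative of `z ↦ ‖z‖ ^ α • z` is Lipschitz on balls; this is where `α ≥ 2` (rather than
`α > 0`) enters. -/
theorem norm_powerDeriv_sub_le {α R : ℝ} (hα : 2 ≤ α) {z w : V} (hz : ‖z‖ ≤ R) (hw : ‖w‖ ≤ R)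
    (h : V) : ‖powerDeriv α z h - powerDeriv α w h‖ ≤
      (α * (3 + α) * R ^ (α - 1)) * ‖z - w‖ * ‖h‖ := by
  wlog hzw : ‖w‖ ≤ ‖z‖ generalizing z w
  · rw [norm_sub_rev, norm_sub_rev z w]
    exact this hw hz (le_of_not_ge hzw)
  have hR : 0 ≤ R := (norm_nonneg z).trans hz
  have hα0 : 0 ≤ α := by linarith
  set A := ‖z‖ ^ (α - 2) with hA
  set B := ‖w‖ ^ (α - 2) with hB
  have hA0 : 0 ≤ A := by positivity
  have hB0 : 0 ≤ B := by positivity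
  have hBA : B ≤ A := Real.rpow_le_rpow (norm_nonneg w) hzw (by linarith)
  have h1 : |‖z‖ ^ α - ‖w‖ ^ α| ≤ α * R ^ (α - 1) * ‖z - w‖ :=
    (abs_rpow_sub_rpow_le (by linarith) (norm_nonneg z) hz (norm_nonneg w) hw).trans
      (mul_le_mul_of_nonneg_left (abs_norm_sub_norm_le z w) (by positivity))
  have e : powerDeriv α z h - powerDeriv α w h = (‖z‖ ^ α - ‖w‖ ^ α) • h +
      α • ((A * inner ℝ (z - w) h) • z + (A * inner ℝ w h) • (z - w) +
        ((A - B) * inner ℝ w h) • w) := by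
    simp only [powerDeriv, inner_sub_left, ← hA, ← hB]
    module
  have b1 : ‖(A * inner ℝ (z - w) h) • z‖ ≤ R ^ (α - 1) * (‖z - w‖ * ‖h‖) := by
    rw [norm_smul, norm_mul, Real.norm_of_nonneg hA0]
    have := mul_le_mul (rpow_sub_two_mul_self_le hα (norm_nonneg z) hz)
      (norm_inner_le_norm (𝕜 := ℝ) (z - w) h) (norm_nonneg _) (by positivity)
    linarith
  have b2 : ‖(A * inner ℝ w h) • (z - w)‖ ≤ R ^ (α - 1) * (‖z - w‖ * ‖h‖) := by
    rw [norm_smul, norm_mul, Real.norm_of_nonneg hA0]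
    have i1 : ‖(inner ℝ w h : ℝ)‖ ≤ ‖z‖ * ‖h‖ := (norm_inner_le_norm (𝕜 := ℝ) w h).trans
      (mul_le_mul_of_nonneg_right hzw (norm_nonneg h))
    have i2 := mul_le_mul_of_nonneg_right (rpow_sub_two_mul_self_le hα (norm_nonneg z) hz)
      (mul_nonneg (norm_nonneg (z - w)) (norm_nonneg h))
    have i3 := mul_le_mul_of_nonneg_left i1 (mul_nonneg hA0 (norm_nonneg (z - w)))
    linarith
  have b3 : ‖((A - B) * inner ℝ w h) • w‖ ≤ α * R ^ (α - 1) * ‖z - w‖ * ‖h‖ := by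
    rw [norm_smul, norm_mul, Real.norm_of_nonneg (by linarith)]
    have i1 := mul_le_mul_of_nonneg_right (norm_inner_le_norm (𝕜 := ℝ) w h) (norm_nonneg w)
    have i2 := mul_le_mul_of_nonneg_left i1 (sub_nonneg.2 hBA)
    -- Since `‖w‖ ≤ ‖z‖`, the difference of the powers of order `α - 2`, which need not be
    -- Lipschitz, times `‖w‖ ^ 2` is at most the difference of the powers of order `α`.
    have i3 : (A - B) * (‖w‖ * ‖w‖) ≤ ‖z‖ ^ α - ‖w‖ ^ α := by
      rw [← rpow_sub_two_mul_sq hα (norm_nonneg z), ← rpow_sub_two_mul_sq hα (norm_nonneg w),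
        sub_mul]
      gcongr
    have i4 := mul_le_mul_of_nonneg_right (i3.trans ((le_abs_self _).trans h1)) (norm_nonneg h)
    linarith
  have b0 : ‖(‖z‖ ^ α - ‖w‖ ^ α) • h‖ ≤ α * R ^ (α - 1) * ‖z - w‖ * ‖h‖ := by
    rw [norm_smul, Real.norm_eq_abs]
    exact mul_le_mul_of_nonneg_right h1 (norm_nonneg h)
  rw [e]
  refine (norm_add_le _ _).trans ?_
  rw [norm_smul α, Real.norm_of_nonneg hα0]
  have b4 := (norm_add₃_le (a := (A * inner ℝ (z - w) h) • z) (b := (A * inner ℝ w h) • (z - w))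
    (c := ((A - B) * inner ℝ w h) • w)).trans (add_le_add (add_le_add b1 b2) b3)
  have b5 := mul_le_mul_of_nonneg_left b4 hα0
  refine (add_le_add b0 b5).trans (le_of_eq (by ring))

end PowerMap

/-! ### The Sobolev space `H¹` -/

namespace H1

/-- The inclusion `H¹ → L²`. -/
def toL2L : H1 →L[ℂ] L2 := (WithLp.fstL 2 ℂ L2 L2).comp H1Submodule.subtypeL

theorem toL2_sub (f g : H1) : (f - g).toL2 = f.toL2 - g.toL2 := rfl

theorem weakDeriv_sub (f g : H1) : (f - g).weakDeriv = f.weakDeriv - g.weakDeriv := rfl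

theorem norm_sq (f : H1) : ‖f‖ ^ 2 = ‖f.toL2‖ ^ 2 + ‖f.weakDeriv‖ ^ 2 :=
  WithLp.prod_norm_sq_eq_of_L2 (f : WithLp 2 (L2 × L2))

theorem norm_toL2_le (f : H1) : ‖f.toL2‖ ≤ ‖f‖ :=
  (sq_le_sq₀ (norm_nonneg _) (norm_nonneg f)).1 (by
    rw [norm_sq]; nlinarith [sq_nonneg ‖f.weakDeriv‖])

theorem norm_weakDeriv_le (f : H1) : ‖f.weakDeriv‖ ≤ ‖f‖ :=
  (sq_le_sq₀ (norm_nonneg _) (norm_nonneg f)).1 (by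
    rw [norm_sq]; nlinarith [sq_nonneg ‖f.toL2‖])

theorem norm_le (f : H1) : ‖f‖ ≤ ‖f.toL2‖ + ‖f.weakDeriv‖ :=
  (sq_le_sq₀ (norm_nonneg f) (by positivity)).1 (by
    rw [norm_sq]; nlinarith [norm_nonneg f.toL2, norm_nonneg f.weakDeriv])

/-- An element of `H¹` is determined by its underlying function. -/
theorem toL2_injective : Function.Injective (toL2 : H1 → L2) := by
  intro f g h
  have hd : (f - g).toL2 = 0 := by rw [toL2_sub, h, sub_self]
  have h1 : ∂_{(1 : ℝ)} ((f - g).toL2 : 𝓢'(ℝ, ℂ)) = ((f - g).weakDeriv : 𝓢'(ℝ, ℂ)) := (f - g).2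
  rw [lineDeriv_eq_iff, hd] at h1
  have h0 : (𝓕 (0 : L2) : L2) = 0 := (Lp.fourierTransformₗᵢ ℝ ℂ).map_zero
  have h2 : (𝓕 (f - g).weakDeriv : L2) = 0 := by
    ext1
    filter_upwards [h1, Lp.coeFn_zero ℂ 2 (volume : Measure ℝ)] with ξ e1 e2
    rw [e1, h0, e2]
    simp
  have h3 : (f - g).weakDeriv = 0 := (Lp.fourierTransformₗᵢ ℝ ℂ).map_eq_zero_iff.1 h2
  have : ‖f - g‖ ≤ 0 := by simpa [hd, h3] using norm_le (f - g)
  exact sub_eq_zero.1 (norm_le_zero_iff.1 this)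

end H1

/-- The distributional derivative is continuous, so its graph in `L² × L²` is closed. -/
theorem isClosed_H1Submodule : IsClosed (H1Submodule : Set (WithLp 2 (L2 × L2))) := by
  refine isClosed_eq (f := fun p : WithLp 2 (L2 × L2) ↦ ∂_{(1 : ℝ)} (p.fst : 𝓢'(ℝ, ℂ)))
    (g := fun p : WithLp 2 (L2 × L2) ↦ (p.snd : 𝓢'(ℝ, ℂ))) ?_ ?_
  · exact (LineDeriv.continuous_lineDerivOp (1 : ℝ)).comp
      ((Lp.toTemperedDistributionCLM ℂ volume 2).continuous.comp
        (WithLp.fstL 2 ℂ L2 L2).continuous)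
  · exact (Lp.toTemperedDistributionCLM ℂ volume 2).continuous.comp
      (WithLp.sndL 2 ℂ L2 L2).continuous

instance : CompleteSpace H1 := isClosed_H1Submodule.completeSpace_coe

namespace H1

theorem memLp_top (f : H1) : MemLp f.toL2 ∞ (volume : Measure ℝ) :=
  memLp_top_of_bound (Lp.aestronglyMeasurable f.toL2) _ f.exists_ae_bound.choose_spec

/-- The embedding `H¹ → L^∞` as a linear map. -/
def toLInfty : H1 →ₗ[ℂ] Lp ℂ ∞ (volume : Measure ℝ) where
  toFun f := f.memLp_top.toLp _
  map_add' f g := by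
    ext1
    refine (MemLp.coeFn_toLp _).trans ?_
    refine (Lp.coeFn_add f.toL2 g.toL2).trans ?_
    refine EventuallyEq.trans ?_ (Lp.coeFn_add _ _).symm
    exact (MemLp.coeFn_toLp _).symm.add (MemLp.coeFn_toLp _).symm
  map_smul' c f := by
    ext1
    refine (MemLp.coeFn_toLp _).trans ?_
    refine (Lp.coeFn_smul c f.toL2).trans ?_
    refine EventuallyEq.trans ?_ (Lp.coeFn_smul _ _).symm
    exact (MemLp.coeFn_toLp _).symm.const_smul c

theorem toLInfty_coe (f : H1) : toLInfty f =ᵐ[volume] f.toL2 :=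
  f.memLp_top.coeFn_toLp

/-- The Sobolev inequality `‖f‖_∞ ≤ C ‖f‖_{H¹}`: every element of `H¹` is bounded, so the closed
graph theorem provides the constant. -/
theorem exists_sobolev_const : ∃ C : ℝ, 0 ≤ C ∧ ∀ f : H1, ∀ᵐ x, ‖f.toL2 x‖ ≤ C * ‖f‖ := by
  have hcl : ∀ (u : ℕ → H1) (x : H1) (y : Lp ℂ ∞ (volume : Measure ℝ)),
      Tendsto u atTop (𝓝 x) → Tendsto (toLInfty ∘ u) atTop (𝓝 y) → y = toLInfty x := by
    intro u x y hx hy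
    have h1 : Tendsto (fun n ↦ (u n).toL2) atTop (𝓝 x.toL2) := (toL2L.continuous.tendsto x).comp hx
    obtain ⟨ns, hns, h2⟩ := (tendstoInMeasure_of_tendsto_Lp h1).exists_seq_tendsto_ae
    obtain ⟨ms, hms, h3⟩ := (tendstoInMeasure_of_tendsto_Lp
      (hy.comp hns.tendsto_atTop)).exists_seq_tendsto_ae
    ext1
    have h4 : ∀ᵐ t, ∀ n, toLInfty (u n) t = (u n).toL2 t := ae_all_iff.2 fun n ↦ toLInfty_coe _
    filter_upwards [h2, h3, h4, toLInfty_coe x] with t a2 a3 a4 a5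
    rw [a5]
    refine tendsto_nhds_unique a3 ?_
    simp only [Function.comp_apply, a4]
    exact a2.comp hms.tendsto_atTop
  set Λ := ContinuousLinearMap.ofSeqClosedGraph (g := toLInfty) fun u x y ↦ hcl u x y
  refine ⟨‖Λ‖, Λ.opNorm_nonneg, fun f ↦ ?_⟩
  have h1 : ‖toLInfty f‖ ≤ ‖Λ‖ * ‖f‖ := Λ.le_opNorm f
  filter_upwards [toLInfty_coe f, ae_le_eLpNormEssSup (f := (toLInfty f : ℝ → ℂ))] with x e1 e2
  rw [← e1]
  refine le_trans ?_ h1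
  rw [Lp.norm_def, eLpNorm_exponent_top, ← toReal_enorm]
  refine ENNReal.toReal_mono ?_ e2
  rw [← eLpNorm_exponent_top]
  exact Lp.eLpNorm_ne_top _

end H1

/-- A pointwise bound by two functions bounds the `L²` norm by the sum of the norms. -/
theorem norm_le_add_of_ae_le {h f g : L2} {A B : ℝ} (hA : 0 ≤ A) (hB : 0 ≤ B)
    (hle : ∀ᵐ x, ‖h x‖ ≤ A * ‖f x‖ + B * ‖g x‖) : ‖h‖ ≤ A * ‖f‖ + B * ‖g‖ := by
  have mf := (Lp.memLp f).norm
  have mg := (Lp.memLp g).norm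
  have nf : ‖mf.toLp _‖ = ‖f‖ := by rw [Lp.norm_toLp, eLpNorm_norm, Lp.norm_def]
  have ng : ‖mg.toLp _‖ = ‖g‖ := by rw [Lp.norm_toLp, eLpNorm_norm, Lp.norm_def]
  have h1 : ‖h‖ ≤ ‖A • mf.toLp _ + B • mg.toLp _‖ := by
    refine Lp.norm_le_norm_of_ae_le ?_
    filter_upwards [hle, Lp.coeFn_add (A • mf.toLp _) (B • mg.toLp _),
      Lp.coeFn_smul A (mf.toLp _), Lp.coeFn_smul B (mg.toLp _), mf.coeFn_toLp, mg.coeFn_toLp]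
      with x e1 e2 e3 e4 e5 e6
    rw [e2, Pi.add_apply, e3, e4, Pi.smul_apply, Pi.smul_apply, e5, e6]
    exact e1.trans (le_abs_self _)
  refine h1.trans ((norm_add_le _ _).trans ?_)
  rw [norm_smul, norm_smul, nf, ng, Real.norm_of_nonneg hA, Real.norm_of_nonneg hB]

theorem hasDerivAt_schwartz (u : 𝓢(ℝ, ℂ)) (x : ℝ) : HasDerivAt u ((∂_{(1 : ℝ)} u) x) x := by
  rw [SchwartzMap.lineDerivOp_apply_eq_fderiv, fderiv_apply_one_eq_deriv]
  exact (u.differentiableAt).hasDerivAt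

/-- A classical derivative which is square integrable is a distributional derivative. -/
theorem lineDeriv_eq_of_hasDerivAt {f g : L2} {F F' : ℝ → ℂ} (hF : ∀ x, HasDerivAt F (F' x) x)
    (hf : f =ᵐ[volume] F) (hg : g =ᵐ[volume] F') :
    ∂_{(1 : ℝ)} (f : 𝓢'(ℝ, ℂ)) = (g : 𝓢'(ℝ, ℂ)) := by
  ext u
  have mF : MemLp F 2 (volume : Measure ℝ) := (Lp.memLp f).ae_eq hf
  have mF' : MemLp F' 2 (volume : Measure ℝ) := (Lp.memLp g).ae_eq hg
  have key := integral_mul_deriv_eq_deriv_mul_of_integrable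
    (u := F) (v := u) (fun x _ ↦ hF x) (fun x _ ↦ hasDerivAt_schwartz u x)
    (mF.integrable_mul ((∂_{(1 : ℝ)} u).memLp 2 volume)) (mF'.integrable_mul (u.memLp 2 volume))
    (mF.integrable_mul (u.memLp 2 volume))
  rw [TemperedDistribution.lineDerivOp_apply_apply, Lp.toTemperedDistribution_apply,
    Lp.toTemperedDistribution_apply]
  have e1 : ∫ x, (-∂_{(1 : ℝ)} u) x • f x = -∫ x, F x * (∂_{(1 : ℝ)} u) x := by
    rw [← integral_neg]
    refine integral_congr_ae ?_
    filter_upwards [hf] with x hx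
    rw [hx, _root_.neg_apply, smul_eq_mul]
    ring
  have e2 : ∫ x, u x • g x = ∫ x, F' x * u x := by
    refine integral_congr_ae ?_
    filter_upwards [hg] with x hx
    rw [hx, smul_eq_mul, mul_comm]
  rw [e1, e2, key, neg_neg]

namespace H1

/-- A Schwartz function and its derivative. -/
def schwartzPair (u : 𝓢(ℝ, ℂ)) : WithLp 2 (L2 × L2) :=
  WithLp.toLp 2 ((u.toLp 2 volume : L2), ((∂_{(1 : ℝ)} u).toLp 2 volume : L2))

theorem schwartzPair_mem (u : 𝓢(ℝ, ℂ)) : schwartzPair u ∈ H1Submodule := by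
  have h := lineDeriv_eq_of_hasDerivAt (f := u.toLp 2 volume) (g := (∂_{(1 : ℝ)} u).toLp 2 volume)
    (F := u) (F' := fun x ↦ (∂_{(1 : ℝ)} u) x)
    (hasDerivAt_schwartz u) (u.coeFn_toLp 2 volume) ((∂_{(1 : ℝ)} u).coeFn_toLp 2 volume)
  exact h

/-- A Schwartz function as an element of `H¹`. -/
def ofSchwartz (u : 𝓢(ℝ, ℂ)) : H1 := ⟨schwartzPair u, schwartzPair_mem u⟩

theorem coe_toL2_ofSchwartz (u : 𝓢(ℝ, ℂ)) : (ofSchwartz u).toL2 =ᵐ[volume] u :=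
  u.coeFn_toLp 2 volume

theorem coe_weakDeriv_ofSchwartz (u : 𝓢(ℝ, ℂ)) :
    (ofSchwartz u).weakDeriv =ᵐ[volume] (∂_{(1 : ℝ)} u : 𝓢(ℝ, ℂ)) :=
  (∂_{(1 : ℝ)} u).coeFn_toLp 2 volume

/-- On the Fourier side, `H¹` is the weighted space `L²((1 + |ξ|²) dξ)`, in which smooth compactly
supported functions are dense. -/
theorem denseRange_ofSchwartz : DenseRange ofSchwartz := by
  intro f
  rw [Metric.mem_closure_range_iff]
  intro ε hε
  set F : L2 := 𝓕 f.toL2 with hF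
  have hf : ∂_{(1 : ℝ)} (f.toL2 : 𝓢'(ℝ, ℂ)) = (f.weakDeriv : 𝓢'(ℝ, ℂ)) := f.2
  rw [lineDeriv_eq_iff] at hf
  -- The weight: `f ↦ m * 𝓕 f` maps `H¹` into `L²`.
  set m : ℝ → ℂ := fun ξ ↦ 1 + 2 * Real.pi * Complex.I * ξ with hm
  have hm1 : ∀ ξ, 1 ≤ ‖m ξ‖ := fun ξ ↦ by
    have := Complex.abs_re_le_norm (m ξ)
    simpa [hm] using this
  have hm2 : ∀ ξ : ℝ, ‖(2 * Real.pi * Complex.I * ξ : ℂ)‖ ≤ ‖m ξ‖ := fun ξ ↦ by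
    have := Complex.abs_im_le_norm (m ξ)
    simpa [hm, abs_mul] using this
  have hne : ∀ ξ, m ξ ≠ 0 := fun ξ h ↦ by
    have := hm1 ξ
    rw [h, norm_zero] at this
    linarith
  have hg : MemLp (fun ξ ↦ m ξ * F ξ) 2 (volume : Measure ℝ) := by
    refine ((Lp.memLp F).add ((Lp.memLp (𝓕 f.weakDeriv : L2)).ae_eq hf)).ae_eq ?_
    filter_upwards with ξ
    simp only [Pi.add_apply, hm]
    ring
  obtain ⟨k, hk, hk', hkε⟩ := hg.exist_eLpNorm_sub_le (by simp) (by norm_num)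
    (show 0 < ε / 4 by positivity)
  have hmc : ContDiff ℝ ∞ m := by
    have : ContDiff ℝ ∞ (fun ξ : ℝ ↦ (ξ : ℂ)) := Complex.ofRealCLM.contDiff
    exact contDiff_const.add (contDiff_const.mul this)
  have hψ₁ : HasCompactSupport fun ξ ↦ (m ξ)⁻¹ * k ξ := hk.mul_left
  have hψ₂ : ContDiff ℝ ∞ fun ξ ↦ (m ξ)⁻¹ * k ξ := (hmc.inv hne).mul hk'
  set ψ : 𝓢(ℝ, ℂ) := hψ₁.toSchwartzMap hψ₂ with hψ
  set u : 𝓢(ℝ, ℂ) := 𝓕⁻ ψ with hu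
  refine ⟨u, ?_⟩
  set d := f - ofSchwartz u with hd
  have h1 : (𝓕 d.toL2 : L2) = F - ψ.toLp 2 volume := by
    have e : (𝓕 (u.toLp 2 volume) : L2) = ψ.toLp 2 volume := by
      rw [SchwartzMap.toLp_fourier_eq, hu, fourier_fourierInv_eq]
    rw [← e]
    exact (Lp.fourierTransformₗᵢ ℝ ℂ).map_sub f.toL2 (u.toLp 2 volume)
  have h2 : ∂_{(1 : ℝ)} (d.toL2 : 𝓢'(ℝ, ℂ)) = (d.weakDeriv : 𝓢'(ℝ, ℂ)) := d.2
  rw [lineDeriv_eq_iff] at h2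
  set e : L2 := (hg.sub ((hk'.continuous.memLp_of_hasCompactSupport hk) :
    MemLp k 2 (volume : Measure ℝ))).toLp _ with he
  have hen : ‖e‖ ≤ ε / 4 := by
    rw [he, Lp.norm_toLp]
    exact ENNReal.toReal_le_of_le_ofReal (by positivity) hkε
  have hae : ∀ᵐ ξ, e ξ = m ξ * (𝓕 d.toL2 : L2) ξ := by
    rw [h1]
    filter_upwards [MemLp.coeFn_toLp (hg.sub ((hk'.continuous.memLp_of_hasCompactSupport hk) :
      MemLp k 2 (volume : Measure ℝ))), Lp.coeFn_sub F (ψ.toLp 2 volume), ψ.coeFn_toLp 2 volume]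
      with ξ a1 a2 a3
    rw [he, a1, a2, Pi.sub_apply, Pi.sub_apply, a3]
    have : ψ ξ = (m ξ)⁻¹ * k ξ := rfl
    rw [this, mul_sub, mul_inv_cancel_left₀ (hne ξ)]
  have n1 : ‖d.toL2‖ ≤ ‖e‖ := by
    rw [← (Lp.fourierTransformₗᵢ ℝ ℂ).norm_map d.toL2]
    refine Lp.norm_le_norm_of_ae_le ?_
    filter_upwards [hae] with ξ a1
    rw [a1, norm_mul]
    exact le_mul_of_one_le_left (norm_nonneg _) (hm1 ξ)
  have n2 : ‖d.weakDeriv‖ ≤ ‖e‖ := by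
    rw [← (Lp.fourierTransformₗᵢ ℝ ℂ).norm_map d.weakDeriv]
    refine Lp.norm_le_norm_of_ae_le ?_
    filter_upwards [hae, h2] with ξ a1 a2
    rw [a1, norm_mul]
    refine (congrArg norm a2).trans_le ?_
    rw [norm_mul]
    exact mul_le_mul_of_nonneg_right (hm2 ξ) (norm_nonneg _)
  rw [dist_eq_norm]
  have := norm_le d
  linarith

end H1

/-! ### The power nonlinearity on `H¹` -/

theorem coe_power {α : ℝ} (hα : 0 ≤ α) (f : H1) :
    power α f =ᵐ[volume] fun x ↦ ‖f.toL2 x‖ ^ α • f.toL2 x := by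
  rw [power, dif_pos hα]
  filter_upwards [(memLp_power hα f).coeFn_toLp] with x hx
  rw [hx, Complex.real_smul]

theorem memLp_powerDeriv {α : ℝ} (hα : 2 ≤ α) (f : H1) :
    MemLp (fun x ↦ powerDeriv α (f.toL2 x) (f.weakDeriv x)) 2 (volume : Measure ℝ) := by
  obtain ⟨C, hC⟩ := f.exists_ae_bound
  have hm := (Lp.aestronglyMeasurable f.toL2).prodMk (Lp.aestronglyMeasurable f.weakDeriv)
  have hm' := (continuous_powerDeriv (V := ℂ) hα).comp_aestronglyMeasurable hm
  refine (Lp.memLp f.weakDeriv).of_le_mul (c := (1 + α) * C ^ α) hm' ?_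
  filter_upwards [hC] with x hx
  exact norm_powerDeriv_le hα hx _

/-- The weak derivative of `|f|^α f`, according to the chain rule. -/
def powerGrad {α : ℝ} (hα : 2 ≤ α) (f : H1) : L2 := (memLp_powerDeriv hα f).toLp _

theorem coe_powerGrad {α : ℝ} (hα : 2 ≤ α) (f : H1) :
    powerGrad hα f =ᵐ[volume] fun x ↦ powerDeriv α (f.toL2 x) (f.weakDeriv x) :=
  (memLp_powerDeriv hα f).coeFn_toLp

theorem exists_norm_power_sub_le {α : ℝ} (hα : 2 ≤ α) (R : ℝ) :
    ∃ K : ℝ, ∀ f ∈ closedBall (0 : H1) R, ∀ g ∈ closedBall (0 : H1) R,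
      ‖power α f - power α g‖ ≤ K * ‖f - g‖ ∧
      ‖powerGrad hα f - powerGrad hα g‖ ≤ K * ‖f - g‖ := by
  obtain ⟨C, hC0, hC⟩ := H1.exists_sobolev_const
  rcases lt_or_ge R 0 with hR | hR
  · exact ⟨0, fun f hf ↦ by simp [closedBall_eq_empty.2 hR] at hf⟩
  set S := C * R with hS
  have hS0 : 0 ≤ S := by positivity
  set K₁ := S ^ α + α * S ^ (α - 1) * S with hK₁
  set K₂ := (1 + α) * S ^ α with hK₂
  set K₃ := α * (3 + α) * S ^ (α - 1) with hK₃
  have hα0 : 0 ≤ α := by linarith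
  have hK₁0 : 0 ≤ K₁ := by positivity
  have hK₂0 : 0 ≤ K₂ := by positivity
  have hK₃0 : 0 ≤ K₃ := by positivity
  refine ⟨K₁ + (K₂ + K₃ * C * R), fun f hf g hg ↦ ?_⟩
  rw [mem_closedBall_zero_iff] at hf hg
  have bf : ∀ᵐ x, ‖f.toL2 x‖ ≤ S := by
    filter_upwards [hC f] with x hx using hx.trans (mul_le_mul_of_nonneg_left hf hC0)
  have bg : ∀ᵐ x, ‖g.toL2 x‖ ≤ S := by
    filter_upwards [hC g] with x hx using hx.trans (mul_le_mul_of_nonneg_left hg hC0)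
  have s1 := Lp.coeFn_sub f.toL2 g.toL2
  have s2 := Lp.coeFn_sub f.weakDeriv g.weakDeriv
  constructor
  · have h1 : ‖power α f - power α g‖ ≤ K₁ * ‖f.toL2 - g.toL2‖ := by
      refine Lp.norm_le_mul_norm_of_ae_le_mul ?_
      filter_upwards [bf, bg, s1, Lp.coeFn_sub (power α f) (power α g), coe_power hα0 f,
        coe_power hα0 g] with x a1 a2 a3 a4 a5 a6
      rw [a4, a3, Pi.sub_apply, Pi.sub_apply, a5, a6]
      exact norm_rpow_smul_sub_le (by linarith) a1 a2
    have h2 := mul_le_mul_of_nonneg_left (H1.norm_toL2_le (f - g)) hK₁0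
    rw [H1.toL2_sub] at h2
    have h3 : 0 ≤ (K₂ + K₃ * C * R) * ‖f - g‖ := by positivity
    linarith
  · have h1 : ‖powerGrad hα f - powerGrad hα g‖ ≤
        K₂ * ‖f.weakDeriv - g.weakDeriv‖ + (K₃ * (C * ‖f - g‖)) * ‖g.weakDeriv‖ := by
      refine norm_le_add_of_ae_le hK₂0 (by positivity) ?_
      filter_upwards [bf, bg, s1, s2, Lp.coeFn_sub (powerGrad hα f) (powerGrad hα g),
        coe_powerGrad hα f, coe_powerGrad hα g, hC (f - g)] with x a1 a2 a3 a4 a5 a6 a7 a8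
      rw [H1.toL2_sub, a3, Pi.sub_apply] at a8
      rw [a5, a4, Pi.sub_apply, Pi.sub_apply, a6, a7]
      have e : powerDeriv α (f.toL2 x) (f.weakDeriv x) - powerDeriv α (g.toL2 x) (g.weakDeriv x) =
          powerDeriv α (f.toL2 x) (f.weakDeriv x - g.weakDeriv x) +
          (powerDeriv α (f.toL2 x) (g.weakDeriv x) - powerDeriv α (g.toL2 x) (g.weakDeriv x)) := by
        simp only [powerDeriv, inner_sub_right]
        module
      rw [e]
      refine (norm_add_le _ _).trans (add_le_add (norm_powerDeriv_le hα a1 _)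
        ((norm_powerDeriv_sub_le hα a1 a2 _).trans ?_))
      gcongr
    have h2 := mul_le_mul_of_nonneg_left (H1.norm_weakDeriv_le (f - g)) hK₂0
    rw [H1.weakDeriv_sub] at h2
    have h3 := mul_le_mul_of_nonneg_left ((H1.norm_weakDeriv_le g).trans hg)
      (by positivity : 0 ≤ K₃ * (C * ‖f - g‖))
    have h4 : 0 ≤ K₁ * ‖f - g‖ := by positivity
    linarith

/-- The candidate for `|f|^α f` in `H¹`, a function together with its weak derivative. -/
def powerPair {α : ℝ} (hα : 2 ≤ α) (f : H1) : WithLp 2 (L2 × L2) :=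
  WithLp.toLp 2 (power α f, powerGrad hα f)

theorem exists_lipschitzOnWith_powerPair {α : ℝ} (hα : 2 ≤ α) (R : ℝ) :
    ∃ K : ℝ≥0, LipschitzOnWith K (powerPair hα) (closedBall 0 R) := by
  obtain ⟨K, hK⟩ := exists_norm_power_sub_le hα R
  refine ⟨(2 * K).toNNReal, LipschitzOnWith.of_dist_le_mul fun f hf g hg ↦ ?_⟩
  obtain ⟨h1, h2⟩ := hK f hf g hg
  have h3 := norm_nonneg (power α f - power α g)
  have h4 := norm_nonneg (powerGrad hα f - powerGrad hα g)
  rw [dist_eq_norm, dist_eq_norm]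
  have h5 : ‖powerPair hα f - powerPair hα g‖ ≤ 2 * K * ‖f - g‖ := by
    refine (sq_le_sq₀ (norm_nonneg _) (by linarith)).1 ?_
    rw [WithLp.prod_norm_sq_eq_of_L2]
    change ‖power α f - power α g‖ ^ 2 + ‖powerGrad hα f - powerGrad hα g‖ ^ 2 ≤ _
    nlinarith
  exact h5.trans (mul_le_mul_of_nonneg_right (Real.le_coe_toNNReal _) (norm_nonneg _))

/-- The chain rule: `|f|^α f` belongs to `H¹`. It holds for Schwartz functions classically, and
both sides depend continuously on `f`. -/
theorem powerPair_mem {α : ℝ} (hα : 2 ≤ α) (f : H1) : powerPair hα f ∈ H1Submodule := by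
  refine H1.denseRange_ofSchwartz.induction_on
    (p := fun f ↦ powerPair hα f ∈ H1Submodule) f
    (isClosed_H1Submodule.preimage
      (continuous_of_lipschitzOnWith_closedBall (exists_lipschitzOnWith_powerPair hα)))
    fun u ↦ ?_
  refine lineDeriv_eq_of_hasDerivAt (f := power α (H1.ofSchwartz u))
    (g := powerGrad hα (H1.ofSchwartz u)) (F := fun x ↦ ‖u x‖ ^ α • u x)
    (F' := fun x ↦ powerDeriv α (u x) ((∂_{(1 : ℝ)} u : 𝓢(ℝ, ℂ)) x))
    (fun x ↦ hasDerivAt_norm_rpow_smul (by linarith) (hasDerivAt_schwartz u x)) ?_ ?_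
  · filter_upwards [coe_power (by linarith : 0 ≤ α) (H1.ofSchwartz u),
      H1.coe_toL2_ofSchwartz u] with x a1 a2
    rw [a1, a2]
  · filter_upwards [coe_powerGrad hα (H1.ofSchwartz u), H1.coe_toL2_ofSchwartz u,
      H1.coe_weakDeriv_ofSchwartz u] with x a1 a2 a3
    rw [a1, a2, a3]

/-- The power nonlinearity as a map `H¹ → H¹`. -/
def powerH1 {α : ℝ} (hα : 2 ≤ α) (f : H1) : H1 := ⟨powerPair hα f, powerPair_mem hα f⟩

theorem exists_lipschitzOnWith_powerH1 {α : ℝ} (hα : 2 ≤ α) (R : ℝ) :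
    ∃ K : ℝ≥0, LipschitzOnWith K (powerH1 hα) (closedBall 0 R) :=
  exists_lipschitzOnWith_powerPair hα R

/-! ### The Schrödinger group on `H¹` -/

theorem eq_of_fourier_ae_eq {f g : L2} (h : (𝓕 f : L2) =ᵐ[volume] (𝓕 g : L2)) : f = g :=
  (Lp.fourierTransformₗᵢ ℝ ℂ).injective (Lp.ext h)

theorem symbol_add (s t ξ : ℝ) : symbol (s + t) ξ = symbol s ξ * symbol t ξ := by
  rw [symbol, symbol, symbol, ← Complex.exp_add]
  congr 1
  push_cast
  ring

theorem T_add (s t : ℝ) (f : L2) : T (s + t) f = T s (T t f) := by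
  apply eq_of_fourier_ae_eq
  filter_upwards [fourier_T (s + t) f, fourier_T s (T t f), fourier_T t f] with ξ h1 h2 h3
  rw [h1, h2, h3, symbol_add, mul_assoc]

theorem T_zero (f : L2) : T 0 f = f := by
  apply eq_of_fourier_ae_eq
  filter_upwards [fourier_T 0 f] with ξ h1
  rw [h1]
  simp [symbol]

theorem T_symm (r : ℝ) (f : L2) : (T r).symm f = T (-r) f := by
  rw [LinearIsometryEquiv.symm_apply_eq, ← T_add, add_neg_cancel, T_zero]

theorem continuous_inner_mulSymbolFun (g F : L2) :
    Continuous fun t ↦ inner ℂ g (mulSymbolFun t F) := by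
  have e : (fun t ↦ inner ℂ g (mulSymbolFun t F)) =
      fun t ↦ ∫ ξ, inner ℂ (g ξ) (symbol t ξ * F ξ) := by
    ext t
    rw [L2.inner_def]
    refine integral_congr_ae ?_
    filter_upwards [mulSymbolFun_coe t F] with ξ h
    rw [h]
  rw [e]
  refine continuous_of_dominated (bound := fun ξ ↦ ‖g ξ‖ * ‖F ξ‖) (fun t ↦ ?_)
    (fun t ↦ Eventually.of_forall fun ξ ↦ ?_) ?_ (Eventually.of_forall fun ξ ↦ ?_)
  · exact (Lp.aestronglyMeasurable g).inner
      ((continuous_symbol t).aestronglyMeasurable.mul (Lp.aestronglyMeasurable F))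
  · refine (norm_inner_le_norm _ _).trans ?_
    rw [norm_mul, norm_symbol, one_mul]
  · exact (Lp.memLp g).norm.integrable_mul (Lp.memLp F).norm
  · have : Continuous fun t ↦ symbol t ξ := by unfold symbol; fun_prop
    exact continuous_const.inner (this.mul continuous_const)

/-- Strong continuity. As the operators are isometries, it follows from weak continuity. -/
theorem continuous_T (f : L2) : Continuous fun t ↦ T t f := by
  set F : L2 := 𝓕 f
  have hT : ∀ t, T t f = (Lp.fourierTransformₗᵢ ℝ ℂ).symm (mulSymbolFun t F) := fun t ↦ rfl
  simp_rw [hT]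
  refine (Lp.fourierTransformₗᵢ ℝ ℂ).symm.continuous.comp (continuous_iff_continuousAt.2 fun s ↦ ?_)
  have hn : ∀ t, ‖mulSymbolFun t F‖ = ‖F‖ := fun t ↦ (mulSymbol t).norm_map F
  have hsq : ∀ t, ‖mulSymbolFun t F - mulSymbolFun s F‖ ^ 2 =
      ‖F‖ ^ 2 - 2 * (inner ℂ (mulSymbolFun s F) (mulSymbolFun t F)).re + ‖F‖ ^ 2 := by
    intro t
    rw [@norm_sub_sq ℂ, hn, hn, ← inner_re_symm]
    rfl
  have hlim : Tendsto (fun t ↦ ‖mulSymbolFun t F - mulSymbolFun s F‖ ^ 2) (𝓝 s) (𝓝 0) := by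
    have hc : Continuous fun t ↦ ‖mulSymbolFun t F - mulSymbolFun s F‖ ^ 2 := by
      simp_rw [hsq]
      exact (continuous_const.sub (continuous_const.mul (Complex.continuous_re.comp
        (continuous_inner_mulSymbolFun _ F)))).add continuous_const
    simpa using hc.tendsto s
  rw [ContinuousAt, tendsto_iff_norm_sub_tendsto_zero]
  have := (Real.continuous_sqrt.tendsto 0).comp hlim
  simpa [Function.comp_def, Real.sqrt_sq] using this

/-- The Schrödinger group on `H¹` acts by linear isometries. -/
def TH1L (t : ℝ) : H1 →ₗᵢ[ℂ] H1 where
  toFun := TH1 t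
  map_add' f g := H1.toL2_injective ((T t).map_add f.toL2 g.toL2)
  map_smul' c f := H1.toL2_injective ((T t).map_smul c f.toL2)
  norm_map' f := by
    refine (sq_eq_sq₀ (norm_nonneg _) (norm_nonneg f)).1 ?_
    rw [H1.norm_sq f, ← (T t).norm_map f.toL2, ← (T t).norm_map f.weakDeriv]
    exact H1.norm_sq (TH1 t f)

theorem TH1_add (s t : ℝ) (f : H1) : TH1 (s + t) f = TH1 s (TH1 t f) :=
  H1.toL2_injective (T_add s t f.toL2)

theorem TH1_zero (f : H1) : TH1 0 f = f := H1.toL2_injective (T_zero f.toL2)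

theorem continuous_TH1_time (f : H1) : Continuous fun t ↦ TH1 t f := by
  refine Continuous.subtype_mk ?_ _
  exact (WithLp.prod_continuous_toLp 2 L2 L2).comp ((continuous_T _).prodMk (continuous_T _))

theorem isIsometryGroup_TH1L : IsIsometryGroup TH1L :=
  ⟨TH1_zero, TH1_add, continuous_TH1_time⟩

/-! ### Solutions in the interaction picture -/

section Solutions

variable {α : ℝ} (hα : 2 ≤ α)

theorem toL2_conjMap_powerH1 (r : ℝ) (f : H1) :
    (conjMap TH1L (powerH1 hα) r f).toL2 = conjPower α r f :=
  (T_symm r _).symm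

theorem toL2_avgMap_powerH1 (f : H1) : (avgMap TH1L (powerH1 hα) f).toL2 = avgQ α f := by
  have := H1.toL2L.intervalIntegral_comp_comm (intervalIntegrable_conjMap
    (exists_lipschitzOnWith_powerH1 hα) isIsometryGroup_TH1L f 0 1)
  refine this.symm.trans (intervalIntegral.integral_congr fun r _ ↦ ?_)
  exact toL2_conjMap_powerH1 hα r f

end Solutions

/-- The solutions in the sense of Duhamel's formula in `L²` are the mild solutions in `H¹` in the
interaction picture. -/
theorem isSolution_iff_isMildSolution {d : ℝ} {F : ℝ → H1 → L2} {G : ℝ → H1 → H1}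
    (hG : Continuous (Function.uncurry G)) (hFG : ∀ s f, (G s f).toL2 = F s f) {φ : H1} {J : Set ℝ}
    (hJ : J.OrdConnected) (h0 : (0 : ℝ) ∈ J) {v : ℝ → H1} :
    IsSolution d F φ J v ↔
      IsMildSolution (interactionField TH1L d G) φ J fun t ↦ TH1L (-(t * d)) (v t) := by
  have hU := isIsometryGroup_TH1L
  have htd : Continuous fun t : ℝ ↦ t * d := continuous_id.mul continuous_const
  have hcont : ContinuousOn v J ↔ ContinuousOn (fun t ↦ TH1L (-(t * d)) (v t)) J := by
    constructor
    · intro h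
      exact hU.continuousOn_comp htd.neg h
    · intro h
      have := hU.continuousOn_comp htd h
      simpa only [hU.apply_neg] using this
  have hduh : ContinuousOn v J → ∀ t ∈ J, ((v t).toL2 =
      T (t * d) φ.toL2 + Complex.I • ∫ s in (0 : ℝ)..t, T ((t - s) * d) (F s (v s)) ↔
      TH1L (-(t * d)) (v t) =
        φ + ∫ s in (0 : ℝ)..t, interactionField TH1L d G s (TH1L (-(s * d)) (v s))) := by
    intro hv t ht
    have hvt := hv.mono (uIcc_zero_subset hJ h0 ht)
    refine Iff.trans ?_ (duhamel_iff hU hG hvt)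
    rw [← H1.toL2_injective.eq_iff]
    have hint : IntervalIntegrable (fun s ↦ TH1L ((t - s) * d) (G s (v s))) volume 0 t :=
      (hU.continuousOn_comp ((continuous_const.sub continuous_id).mul continuous_const)
        (continuousOn_field_comp hG hvt)).intervalIntegrable
    have e : (∫ s in (0 : ℝ)..t, TH1L ((t - s) * d) (G s (v s))).toL2 =
        ∫ s in (0 : ℝ)..t, T ((t - s) * d) (F s (v s)) := by
      refine (H1.toL2L.intervalIntegral_comp_comm hint).symm.trans
        (intervalIntegral.integral_congr fun s _ ↦ ?_)
      change T ((t - s) * d) (G s (v s)).toL2 = _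
      rw [hFG]
    rw [← e]
    rfl
  constructor
  · intro h
    exact ⟨hcont.1 h.continuousOn, fun t ht ↦ (hduh h.continuousOn t ht).1 (h.duhamel t ht)⟩
  · intro h
    have hc := hcont.2 h.continuousOn
    exact ⟨hc, fun t ht ↦ (hduh hc t ht).2 (h.integral_eq t ht)⟩

/-! ### The dispersion profile -/

theorem measurable_d₀ : Measurable d₀ := by
  unfold d₀
  exact Measurable.ite (measurableSet_lt (measurable_fract.comp (measurable_id.div_const 2))
    measurable_const) measurable_const measurable_const

theorem intervalIntegrable_d₀ (a b : ℝ) : IntervalIntegrable d₀ volume a b := by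
  refine (intervalIntegrable_const (c := (1 : ℝ))).mono_fun
    measurable_d₀.aestronglyMeasurable (Eventually.of_forall fun t ↦ ?_)
  simp only [d₀]
  split_ifs <;> simp

theorem periodic_d₀ : Function.Periodic d₀ 2 := by
  intro t
  rw [d₀, d₀, add_div, div_self two_ne_zero, Int.fract_add_one]

theorem d₀_of_mem_Ioo_zero_one {t : ℝ} (ht : t ∈ Ioo (0 : ℝ) 1) : d₀ t = 1 := by
  rw [d₀, if_pos]
  rw [Int.fract_eq_self.2 ⟨by linarith [ht.1], by linarith [ht.2]⟩]
  linarith [ht.2]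

theorem d₀_of_mem_Ioo_one_two {t : ℝ} (ht : t ∈ Ioo (1 : ℝ) 2) : d₀ t = -1 := by
  rw [d₀, if_neg]
  rw [Int.fract_eq_self.2 ⟨by linarith [ht.1], by linarith [ht.2]⟩]
  linarith [ht.1]

theorem D_of_mem_Icc_zero_one {t : ℝ} (ht : t ∈ Icc (0 : ℝ) 1) : D t = t := by
  have : ∫ s in (0 : ℝ)..t, d₀ s = ∫ _ in (0 : ℝ)..t, (1 : ℝ) :=
    intervalIntegral.integral_congr_Ioo_of_le ht.1 fun s hs ↦
      d₀_of_mem_Ioo_zero_one ⟨hs.1, hs.2.trans_le ht.2⟩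
  rw [D, this]
  simp

theorem D_of_mem_Icc_one_two {t : ℝ} (ht : t ∈ Icc (1 : ℝ) 2) : D t = 2 - t := by
  have h1 : ∫ s in (1 : ℝ)..t, d₀ s = ∫ _ in (1 : ℝ)..t, (-1 : ℝ) :=
    intervalIntegral.integral_congr_Ioo_of_le ht.1 fun s hs ↦
      d₀_of_mem_Ioo_one_two ⟨hs.1, hs.2.trans_le ht.2⟩
  have h2 : D 1 = 1 := D_of_mem_Icc_zero_one ⟨zero_le_one, le_rfl⟩
  rw [D] at h2
  rw [D, ← intervalIntegral.integral_add_adjacent_intervals (intervalIntegrable_d₀ 0 1)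
    (intervalIntegrable_d₀ 1 t), h1, h2]
  simp
  ring

theorem continuous_D : Continuous D :=
  intervalIntegral.continuous_primitive intervalIntegrable_d₀ 0

theorem periodic_D : Function.Periodic D 2 := by
  intro t
  have h := periodic_d₀.intervalIntegral_add_eq t 0
  have h2 : D 2 = 2 - 2 := D_of_mem_Icc_one_two ⟨one_le_two, le_rfl⟩
  rw [D] at h2
  rw [D, ← intervalIntegral.integral_add_adjacent_intervals (intervalIntegrable_d₀ 0 t)
    (intervalIntegrable_d₀ t (t + 2)), h, zero_add, h2, D]
  ring

/-- Over a period, `D` runs through `[0, 1]` twice, with unit speed. -/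
theorem integral_comp_D {E : Type*} [NormedAddCommGroup E] [NormedSpace ℝ E] {ψ : ℝ → E}
    (hψ : Continuous ψ) :
    ∫ τ in (0 : ℝ)..2, ψ (D τ) = (2 : ℝ) • ∫ r in (0 : ℝ)..1, ψ r := by
  have hc : Continuous fun τ ↦ ψ (D τ) := hψ.comp continuous_D
  have h1 : ∫ τ in (0 : ℝ)..1, ψ (D τ) = ∫ r in (0 : ℝ)..1, ψ r :=
    intervalIntegral.integral_congr fun τ hτ ↦ by
      rw [uIcc_of_le zero_le_one] at hτ
      simp only [D_of_mem_Icc_zero_one hτ]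
  have h2 : ∫ τ in (1 : ℝ)..2, ψ (D τ) = ∫ r in (0 : ℝ)..1, ψ r := by
    have : ∫ τ in (1 : ℝ)..2, ψ (D τ) = ∫ τ in (1 : ℝ)..2, ψ (2 - τ) :=
      intervalIntegral.integral_congr fun τ hτ ↦ by
        rw [uIcc_of_le one_le_two] at hτ
        simp only [D_of_mem_Icc_one_two hτ]
    rw [this, intervalIntegral.integral_comp_sub_left (fun r ↦ ψ r)]
    norm_num
  rw [← intervalIntegral.integral_add_adjacent_intervals (hc.intervalIntegrable 0 1)
    (hc.intervalIntegrable 1 2), h1, h2, two_smul]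

/-! ### Maximal solutions -/

theorem isOpen_timeInterval (a b : EReal) : IsOpen (timeInterval a b) :=
  isOpen_Ioo.preimage continuous_coe_real_ereal

theorem ordConnected_timeInterval (a b : EReal) : (timeInterval a b).OrdConnected :=
  ordConnected_Ioo.preimage_mono fun _ _ h ↦ EReal.coe_le_coe_iff.2 h

theorem zero_mem_timeInterval {a b : EReal} (ha : 0 < a) (hb : 0 < b) :
    (0 : ℝ) ∈ timeInterval a b := by
  refine ⟨?_, by simpa using hb⟩
  rw [EReal.neg_lt_comm]
  simpa using ha

theorem timeInterval_mono {a b a' b' : EReal} (ha : a ≤ a') (hb : b ≤ b') :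
    timeInterval a b ⊆ timeInterval a' b' :=
  fun _ ht ↦ ⟨(EReal.neg_le_neg_iff.2 ha).trans_lt ht.1, ht.2.trans_le hb⟩

theorem Icc_subset_timeInterval {M : ℝ} {a b : EReal} (ha : (M : EReal) < a)
    (hb : (M : EReal) < b) : Icc (-M) M ⊆ timeInterval a b := by
  intro t ht
  refine ⟨?_, (EReal.coe_le_coe_iff.2 ht.2).trans_lt hb⟩
  rw [EReal.neg_lt_comm, ← EReal.coe_neg]
  exact (EReal.coe_le_coe_iff.2 (by linarith [ht.1])).trans_lt ha

theorem timeInterval_coe (M : ℝ) : timeInterval M M = Ioo (-M) M := by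
  ext t
  simp only [timeInterval, mem_ofPred_eq, mem_Ioo, ← EReal.coe_neg, EReal.coe_lt_coe_iff]

theorem IsSolution.mono {d : ℝ} {F : ℝ → H1 → L2} {φ : H1} {J J' : Set ℝ} {v : ℝ → H1}
    (h : IsSolution d F φ J v) (hJ : J' ⊆ J) : IsSolution d F φ J' v :=
  ⟨h.continuousOn.mono hJ, fun t ht ↦ h.duhamel t (hJ ht)⟩

theorem IsSolution.congr {d : ℝ} {F : ℝ → H1 → L2} {φ : H1} {J : Set ℝ} {v v' : ℝ → H1}
    (h : IsSolution d F φ J v) (hJ : J.OrdConnected) (h0 : (0 : ℝ) ∈ J) (hv : EqOn v' v J) :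
    IsSolution d F φ J v' := by
  refine ⟨h.continuousOn.congr hv, fun t ht ↦ ?_⟩
  rw [hv ht, h.duhamel t ht]
  congr 2
  refine intervalIntegral.integral_congr fun s hs ↦ ?_
  simp only [hv (uIcc_zero_subset hJ h0 ht hs)]

/-- Well-posedness for short times: solutions are unique on intervals, and exist on some
interval. -/
structure IsLocallyWellPosed (d : ℝ) (F : ℝ → H1 → L2) (φ : H1) : Prop where
  eqOn : ∀ (J : Set ℝ) (v v' : ℝ → H1), J.OrdConnected → (0 : ℝ) ∈ J →
    IsSolution d F φ J v → IsSolution d F φ J v' → EqOn v v' J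
  exists_isSolution : ∃ a : ℝ, 0 < a ∧ ∃ v, IsSolution d F φ (timeInterval a a) v

section Maximal

variable {d : ℝ} {F : ℝ → H1 → L2} {φ : H1}

/-- The union of all solutions on open intervals is a solution, on the largest interval. -/
theorem IsLocallyWellPosed.exists_largest (h : IsLocallyWellPosed d F φ) :
    ∃ (Tm Tp : EReal) (v : ℝ → H1), 0 < Tm ∧ 0 < Tp ∧ IsSolution d F φ (timeInterval Tm Tp) v ∧
      ∀ (a b : EReal) (v' : ℝ → H1), 0 < a → 0 < b → IsSolution d F φ (timeInterval a b) v' →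
        a ≤ Tm ∧ b ≤ Tp := by
  classical
  -- The pairs of endpoints for which there is a solution.
  set S : Set (EReal × EReal) :=
    {p | 0 < p.1 ∧ 0 < p.2 ∧ ∃ v, IsSolution d F φ (timeInterval p.1 p.2) v} with hS
  set Tm := sSup (Prod.fst '' S) with hTm
  set Tp := sSup (Prod.snd '' S) with hTp
  have hle : ∀ p ∈ S, p.1 ≤ Tm ∧ p.2 ≤ Tp := fun p hp ↦
    ⟨le_sSup (mem_image_of_mem _ hp), le_sSup (mem_image_of_mem _ hp)⟩
  have hcover : ∀ t ∈ timeInterval Tm Tp, ∃ p ∈ S, t ∈ timeInterval p.1 p.2 := by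
    intro t ht
    rcases le_total 0 t with h0 | h0
    · obtain ⟨_, ⟨p, hp, rfl⟩, hlt⟩ := lt_sSup_iff.1 ht.2
      refine ⟨p, hp, lt_of_lt_of_le ?_ (EReal.coe_le_coe_iff.2 h0), hlt⟩
      exact (zero_mem_timeInterval hp.1 hp.2.1).1
    · obtain ⟨_, ⟨p, hp, rfl⟩, hlt⟩ := lt_sSup_iff.1 (EReal.neg_lt_comm.1 ht.1)
      refine ⟨p, hp, EReal.neg_lt_comm.1 hlt, lt_of_le_of_lt (EReal.coe_le_coe_iff.2 h0) ?_⟩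
      exact (zero_mem_timeInterval hp.1 hp.2.1).2
  have hchoice : ∀ t, ∃ (p : EReal × EReal) (u : ℝ → H1), t ∈ timeInterval Tm Tp →
      p ∈ S ∧ t ∈ timeInterval p.1 p.2 ∧ IsSolution d F φ (timeInterval p.1 p.2) u := by
    intro t
    by_cases ht : t ∈ timeInterval Tm Tp
    · obtain ⟨p, hp, hpt⟩ := hcover t ht
      obtain ⟨u, hu⟩ := hp.2.2
      exact ⟨p, u, fun _ ↦ ⟨hp, hpt, hu⟩⟩
    · exact ⟨0, fun _ ↦ 0, fun h ↦ absurd h ht⟩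
  choose p u hpu using hchoice
  -- By uniqueness, the diagonal choice `s ↦ u s s` agrees with each of the chosen solutions on its
  -- whole interval.
  have hglue : ∀ t ∈ timeInterval Tm Tp,
      EqOn (fun s ↦ u s s) (u t) (timeInterval (p t).1 (p t).2) := by
    intro t ht s hs
    obtain ⟨hp, -, hu⟩ := hpu t ht
    obtain ⟨hp', hs', hu'⟩ := hpu s (timeInterval_mono (hle _ hp).1 (hle _ hp).2 hs)
    exact h.eqOn (timeInterval (p t).1 (p t).2 ∩ timeInterval (p s).1 (p s).2) (u s) (u t)
      ((ordConnected_timeInterval _ _).inter (ordConnected_timeInterval _ _))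
      ⟨zero_mem_timeInterval hp.1 hp.2.1, zero_mem_timeInterval hp'.1 hp'.2.1⟩
      (hu'.mono inter_subset_right) (hu.mono inter_subset_left) ⟨hs, hs'⟩
  have hloc : ∀ t ∈ timeInterval Tm Tp,
      IsSolution d F φ (timeInterval (p t).1 (p t).2) fun s ↦ u s s := fun t ht ↦
    (hpu t ht).2.2.congr (ordConnected_timeInterval _ _)
      (zero_mem_timeInterval (hpu t ht).1.1 (hpu t ht).1.2.1) (hglue t ht)
  obtain ⟨a, ha, v, hv⟩ := h.exists_isSolution
  have haS : ((a : EReal), (a : EReal)) ∈ S :=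
    ⟨EReal.coe_pos.2 ha, EReal.coe_pos.2 ha, v, hv⟩
  refine ⟨Tm, Tp, fun s ↦ u s s, (EReal.coe_pos.2 ha).trans_le (hle _ haS).1,
    (EReal.coe_pos.2 ha).trans_le (hle _ haS).2, ⟨fun t ht ↦ ?_, fun t ht ↦ ?_⟩,
    fun a b v' ha hb hv' ↦ hle (a, b) ⟨ha, hb, v', hv'⟩⟩
  · exact (((hloc t ht).continuousOn t (hpu t ht).2.1).continuousAt
      ((isOpen_timeInterval _ _).mem_nhds (hpu t ht).2.1)).continuousWithinAt
  · exact (hloc t ht).duhamel t (hpu t ht).2.1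

theorem IsLocallyWellPosed.hasUniqueMaximalSolution (h : IsLocallyWellPosed d F φ) :
    HasUniqueMaximalSolution d F φ := by
  obtain ⟨Tm, Tp, v, hm, hp, hv, hmax⟩ := h.exists_largest
  refine ⟨Tm, Tp, v, ⟨hm, hp, hv, fun a b v' ha hb hv' _ ↦ ?_⟩, fun a b v' hv' ↦ ?_⟩
  · obtain ⟨h1, h2⟩ := hmax a b v' (hm.trans_le ha) (hp.trans_le hb) hv'
    exact ⟨le_antisymm h1 ha, le_antisymm h2 hb⟩
  · obtain ⟨h1, h2⟩ := hmax a b v' hv'.pos_left hv'.pos_right hv'.isSolution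
    have heq : EqOn v v' (timeInterval a b) := h.eqOn _ _ _ (ordConnected_timeInterval _ _)
      (zero_mem_timeInterval hv'.pos_left hv'.pos_right) (hv.mono (timeInterval_mono h1 h2))
      hv'.isSolution
    obtain ⟨rfl, rfl⟩ := hv'.maximal Tm Tp v h1 h2 hv heq
    exact ⟨rfl, rfl, heq.symm⟩

/-- Every solution is contained in the maximal one. -/
theorem IsMaximalSolution.le_of_isSolution (h : IsLocallyWellPosed d F φ) {Tm Tp : EReal}
    {v : ℝ → H1} (hv : IsMaximalSolution d F φ Tm Tp v) {a b : EReal} {v' : ℝ → H1} (ha : 0 < a)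
    (hb : 0 < b) (hv' : IsSolution d F φ (timeInterval a b) v') : a ≤ Tm ∧ b ≤ Tp := by
  obtain ⟨Sm, Sp, u, hm, hp, hu, hmax⟩ := h.exists_largest
  obtain ⟨h1, h2⟩ := hmax Tm Tp v hv.pos_left hv.pos_right hv.isSolution
  obtain ⟨rfl, rfl⟩ := hv.maximal Sm Sp u h1 h2 hu
    (h.eqOn _ _ _ (ordConnected_timeInterval _ _)
      (zero_mem_timeInterval hv.pos_left hv.pos_right) (hu.mono (timeInterval_mono h1 h2))
      hv.isSolution)
  exact hmax a b v' ha hb hv'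

end Maximal

/-! ### Local well-posedness -/

/-- Short-time existence: by continuity, the global solution for the truncated field stays for a
while in the ball where the truncation is inactive. -/
theorem exists_isMildSolution_local {E : Type*} [NormedAddCommGroup E] [NormedSpace ℝ E]
    [CompleteSpace E] {g : ℝ → E → E} (hg : IsLocallyLipschitzField g) (φ : E) :
    ∃ a > 0, ∃ w, IsMildSolution g φ (Ioo (-a) a) w := by
  have hR : 0 < ‖φ‖ + 1 := by positivity
  obtain ⟨w, hw⟩ := exists_isMildSolution_truncation hg φ hR 1
  have h0 : (0 : ℝ) ∈ Icc (-1 : ℝ) 1 := by norm_num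
  have hw0 : w 0 = φ := by simpa using hw.integral_eq 0 h0
  have hc : ContinuousAt w 0 := hw.continuousOn.continuousAt (Icc_mem_nhds (by norm_num) one_pos)
  obtain ⟨a, ha, hball⟩ := Metric.continuousAt_iff.1 hc 1 one_pos
  refine ⟨min a 1, by positivity, w, ?_⟩
  have hsub : Ioo (-min a 1) (min a 1) ⊆ Icc (-1) 1 := fun t ht ↦
    ⟨by linarith [ht.1, min_le_right a 1], by linarith [ht.2, min_le_right a 1]⟩
  refine ⟨hw.continuousOn.mono hsub, fun t ht ↦ ?_⟩
  rw [hw.integral_eq t (hsub ht)]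
  congr 1
  refine intervalIntegral.integral_congr fun s hs ↦ ?_
  have hs' := uIcc_zero_subset ordConnected_Ioo (by constructor <;> simp [ha]) ht hs
  have := hball (x := s) (by
    rw [Real.dist_eq, sub_zero, abs_lt]
    exact ⟨by linarith [hs'.1, min_le_left a 1], by linarith [hs'.2, min_le_left a 1]⟩)
  rw [hw0, dist_eq_norm] at this
  have h2 := norm_le_norm_sub_add (w s) φ
  rw [radialRetraction_of_le hR (by linarith)]

/-- An equation whose nonlinearity is a locally Lipschitz field on `H¹` is locally well-posed. -/
theorem isLocallyWellPosed_of_field {d : ℝ} {F : ℝ → H1 → L2} {G : ℝ → H1 → H1}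
    (hG : IsLocallyLipschitzField G) (hFG : ∀ s f, (G s f).toL2 = F s f) (φ : H1) :
    IsLocallyWellPosed d F φ := by
  have hU := isIsometryGroup_TH1L
  have hg := hG.interactionField hU (d := d)
  refine ⟨fun J v v' hJ h0 hv hv' t ht ↦ ?_, ?_⟩
  · rw [isSolution_iff_isMildSolution hG.continuous hFG hJ h0] at hv hv'
    exact (TH1L _).injective (hv.eqOn hg hJ h0 hv' ht)
  · obtain ⟨a, ha, w, hw⟩ := exists_isMildSolution_local hg φ
    refine ⟨a, ha, fun t ↦ TH1L (t * d) (w t), ?_⟩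
    rw [timeInterval_coe, isSolution_iff_isMildSolution hG.continuous hFG ordConnected_Ioo
      ⟨by linarith, ha⟩]
    simpa only [hU.neg_apply] using hw

/-! ### The averaging limit -/

section AveragingLimit

variable {dav α : ℝ}

theorem isLocallyLipschitzField_dm (hα : 2 ≤ α) (ε : ℝ) :
    IsLocallyLipschitzField fun s f ↦ conjMap TH1L (powerH1 hα) (D (s / ε)) f :=
  isLocallyLipschitzField_conjMap (exists_lipschitzOnWith_powerH1 hα) isIsometryGroup_TH1L
    (continuous_D.comp (continuous_id.div_const ε))

theorem isLocallyWellPosed_dm (hα : 2 ≤ α) (ε : ℝ) (φ : H1) :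
    IsLocallyWellPosed dav (dmForcing α ε) φ :=
  isLocallyWellPosed_of_field (isLocallyLipschitzField_dm hα ε)
    (fun s f ↦ toL2_conjMap_powerH1 hα (D (s / ε)) f) φ

theorem isLocallyLipschitzField_avg (hα : 2 ≤ α) :
    IsLocallyLipschitzField fun _ f ↦ avgMap TH1L (powerH1 hα) f :=
  isLocallyLipschitzField_avgMap (exists_lipschitzOnWith_powerH1 hα) isIsometryGroup_TH1L

theorem isLocallyWellPosed_avg (hα : 2 ≤ α) (φ : H1) :
    IsLocallyWellPosed dav (avgForcing α) φ :=
  isLocallyWellPosed_of_field (isLocallyLipschitzField_avg hα)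
    (fun _ f ↦ toL2_avgMap_powerH1 hα f) φ

/-- For small `ε`, the maximal solution of the dispersion managed equation exists on `[-M, M]` and
is uniformly close to the solution of the averaged equation. The solution provided by the averaging
principle on a slightly larger interval is part of the maximal one. -/
theorem exists_norm_sub_le_of_isMaximalSolution (hα : 2 ≤ α) {φ : H1} {Tm Tp : EReal}
    {v : ℝ → H1} (hv : IsMaximalSolution dav (avgForcing α) φ Tm Tp v) {Sm Sp : ℝ → EReal}
    {vε : ℝ → ℝ → H1}
    (hvε : ∀ ε : ℝ, 0 < ε → IsMaximalSolution dav (dmForcing α ε) φ (Sm ε) (Sp ε) (vε ε))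
    {M : ℝ} (hM : 0 < M) (hMT : (M : EReal) < min Tm Tp) {δ : ℝ} (hδ : 0 < δ) :
    ∃ ε₀ > 0, ∀ ε, 0 < ε → ε < ε₀ →
      Icc (-M) M ⊆ timeInterval (Sm ε) (Sp ε) ∧ ∀ t ∈ Icc (-M) M, ‖vε ε t - v t‖ ≤ δ := by
  have hU := isIsometryGroup_TH1L
  obtain ⟨M', hMM', hM'T⟩ := EReal.lt_iff_exists_real_btwn.1 hMT
  rw [EReal.coe_lt_coe_iff] at hMM'
  rw [lt_min_iff] at hM'T
  have hM' : 0 < M' := hM.trans hMM'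
  have hw := (isSolution_iff_isMildSolution (isLocallyLipschitzField_avg hα).continuous
    (fun _ f ↦ toL2_avgMap_powerH1 hα f) (ordConnected_timeInterval _ _)
    (zero_mem_timeInterval hv.pos_left hv.pos_right)).1 hv.isSolution
  obtain ⟨ε₀, hε₀, hnear⟩ := exists_isMildSolution_near_avgMap hU
    (exists_lipschitzOnWith_powerH1 hα) continuous_D two_pos
    periodic_D (fun _ hψ ↦ integral_comp_D hψ) hM'.le
    (hw.mono (Icc_subset_timeInterval hM'T.1 hM'T.2)) hδ
  refine ⟨ε₀, hε₀, fun ε hε hlt ↦ ?_⟩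
  obtain ⟨w', hw', hclose⟩ := hnear ε hε hlt
  have hwp := isLocallyWellPosed_dm (dav := dav) hα ε φ
  have h0 : (0 : ℝ) ∈ Ioo (-M') M' := ⟨by linarith, hM'⟩
  have hv' : IsSolution dav (dmForcing α ε) φ (Ioo (-M') M') fun t ↦ TH1L (t * dav) (w' t) := by
    refine (isSolution_iff_isMildSolution (F := dmForcing α ε)
      (isLocallyLipschitzField_dm hα ε).continuous
      (fun s f ↦ toL2_conjMap_powerH1 hα (D (s / ε)) f) ordConnected_Ioo h0).2 ?_
    simp only [hU.neg_apply]
    exact hw'.mono Ioo_subset_Icc_self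
  obtain ⟨h1, h2⟩ := (hvε ε hε).le_of_isSolution hwp (EReal.coe_pos.2 hM')
    (EReal.coe_pos.2 hM') (by rwa [timeInterval_coe])
  have hlt' := EReal.coe_lt_coe_iff.2 hMM'
  have hIoo : Ioo (-M') M' ⊆ timeInterval (Sm ε) (Sp ε) := by
    rw [← timeInterval_coe]
    exact timeInterval_mono h1 h2
  refine ⟨Icc_subset_timeInterval (hlt'.trans_le h1) (hlt'.trans_le h2), fun t ht ↦ ?_⟩
  have ht' : t ∈ Ioo (-M') M' := ⟨by linarith [ht.1], by linarith [ht.2]⟩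
  have e := hwp.eqOn _ _ _ ordConnected_Ioo h0 ((hvε ε hε).isSolution.mono hIoo) hv' ht'
  have e2 : v t = TH1L (t * dav) (TH1L (-(t * dav)) (v t)) := (hU.apply_neg _ _).symm
  rw [e, e2, norm_isometry_sub]
  exact hclose t (Ioo_subset_Icc_self ht')

end AveragingLimit

end DMNLS

end

theorem theorem1p1 (dav α : ℝ) (hα : 2 ≤ α) (φ : DMNLS.H1) :
    DMNLS.HasUniqueMaximalSolution dav (DMNLS.avgForcing α) φ ∧
    (∀ ε : ℝ, 0 < ε → DMNLS.HasUniqueMaximalSolution dav (DMNLS.dmForcing α ε) φ) ∧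
    ∀ (Tm Tp : EReal) (v : ℝ → DMNLS.H1),
      DMNLS.IsMaximalSolution dav (DMNLS.avgForcing α) φ Tm Tp v →
    ∀ (Sm Sp : ℝ → EReal) (vε : ℝ → ℝ → DMNLS.H1),
      (∀ ε : ℝ, 0 < ε →
        DMNLS.IsMaximalSolution dav (DMNLS.dmForcing α ε) φ (Sm ε) (Sp ε) (vε ε)) →
    ∀ M : ℝ, 0 < M → (M : EReal) < min Tm Tp →
      (∃ ε₀ : ℝ, 0 < ε₀ ∧ ∀ ε : ℝ, 0 < ε → ε < ε₀ →
        Set.Icc (-M) M ⊆ DMNLS.timeInterval (Sm ε) (Sp ε)) ∧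
      Filter.Tendsto
        (fun ε : ℝ ↦ eLpNorm (fun t ↦ vε ε t - v t) ∞ (volume.restrict (Set.Icc (-M) M)))
        (nhdsWithin 0 (Set.Ioi 0)) (nhds 0) := by
  refine ⟨(DMNLS.isLocallyWellPosed_avg hα φ).hasUniqueMaximalSolution,
    fun ε _ ↦ (DMNLS.isLocallyWellPosed_dm hα ε φ).hasUniqueMaximalSolution,
    fun Tm Tp v hv Sm Sp vε hvε M hM hMT ↦ ⟨?_, ?_⟩⟩
  · obtain ⟨ε₀, hε₀, h⟩ :=
      DMNLS.exists_norm_sub_le_of_isMaximalSolution hα hv hvε hM hMT one_pos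
    exact ⟨ε₀, hε₀, fun ε hε hlt ↦ (h ε hε hlt).1⟩
  · rw [ENNReal.tendsto_nhds_zero]
    intro η hη
    obtain ⟨δ, hδ, hδη⟩ : ∃ δ : ℝ, 0 < δ ∧ ENNReal.ofReal δ ≤ η := by
      rcases eq_or_ne η ∞ with rfl | hη'
      · exact ⟨1, one_pos, le_top⟩
      · exact ⟨η.toReal, ENNReal.toReal_pos hη.ne' hη', (ENNReal.ofReal_toReal hη').le⟩
    obtain ⟨ε₀, hε₀, h⟩ := DMNLS.exists_norm_sub_le_of_isMaximalSolution hα hv hvε hM hMT hδ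
    filter_upwards [Ioo_mem_nhdsGT hε₀] with ε hε
    refine le_trans ?_ hδη
    rw [eLpNorm_exponent_top]
    exact eLpNormEssSup_le_of_ae_bound
      (ae_restrict_of_forall_mem measurableSet_Icc (h ε hε.1 hε.2).2)
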